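/- Let $\gamma\in\mathbb R$, and let $F=L^\infty(\mathbb R)\times(L^\infty(\mathbb R)\cap L^2(\mathbb R))\times L^\infty(\mathbb R)\times L^2(\mathbb R)\times L^2(\mathbb R)\times L^2(\mathbb R)$ be the Banach space of tuples $Y=(\zeta,U,H,v,w,h)$. For $Y\in F$ put $y(\xi)=\zeta(\xi)+\xi$, $q=v+1$ and $$P=\tfrac12\int_{\mathbb R}e^{-\operatorname{sgn}(\xi-\eta)(y(\xi)-y(\eta))}\Bigl(\tfrac{3-2\gamma}{2}U^2q+\tfrac{\gamma}{2}h\Bigr)(\eta)\,d\eta,$$ $$Q=-\tfrac12\int_{\mathbb R}\operatorname{sgn}(\xi-\eta)\,e^{-\operatorname{sgn}(\xi-\eta)(y(\xi)-y(\eta))}\Bigl(\tfrac{3-2\gamma}{2}U^2q+\tfrac{\gamma}{2}h\Bigr)(\eta)\,d\eta.$$ Let $T>0$ and let $Y\in C^1([0,T],F)$ be a solution of the system $$\zeta_t=\gamma U,\qquad U_t=-Q,\qquad H_t=U^3-2PU,\qquad v_t=\gamma w,$$ $$w_t=\tfrac{\gamma}{2}h+\Bigl(\tfrac{3-2\gamma}{2}U^2-P\Bigr)q,\qquad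 h_t=-2QUq+(3U^2-2P)w .$$ Then each of the following four properties is preserved, independently of the other ones: if it holds for $Y(0)$, then it holds for $Y(t)$ for every $t\in[0,T]$. 1. $q,w,h\in L^\infty(\mathbb R)$. 2. $qh=U^2q^2+w^2$ almost everywhere. 3. $qh=U^2q^2+w^2$ almost everywhere, and there is a constant $c>0$ (which may depend on $t$) such that $q\ge0$, $h\ge0$ and $q+h\ge c$ almost everywhere. 4. $y$, $U$ and $H$ are differentiable with $y_\xi=q$, $U_\xi=w$ and $H_\xi=h$, in the sense that each of $y,U,H$ has a locally absolutely continuous representative whose derivative is, almost everywhere, $q$, $w$, $h$ respectively. -/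

import Mathlib

open MeasureTheory Set
open scoped ENNReal

noncomputable section

namespace HyperelasticRod

/-- The Banach space `L^∞(ℝ) ∩ L²(ℝ)`, realised as the space of pairs `(f, g)` of an `L^∞` class
and an `L²` class which are represented by the same function almost everywhere.  The norm is the
maximum of the two norms, which is equivalent to their sum. -/
def LinfL2 : Submodule ℝ (Lp ℝ ∞ (volume : Measure ℝ) × Lp ℝ 2 (volume : Measure ℝ)) where
  carrier := {p | (p.1 : ℝ → ℝ) =ᵐ[volume] (p.2 : ℝ → ℝ)}
  zero_mem' := (Lp.coeFn_zero ℝ ∞ volume).trans (Lp.coeFn_zero ℝ 2 volume).symm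
  add_mem' := by
    intro a b ha hb
    have hab : (a.1 : ℝ → ℝ) + (b.1 : ℝ → ℝ) =ᵐ[volume] (a.2 : ℝ → ℝ) + (b.2 : ℝ → ℝ) :=
      Filter.EventuallyEq.add ha hb
    exact ((Lp.coeFn_add a.1 b.1).trans hab).trans (Lp.coeFn_add a.2 b.2).symm
  smul_mem' := by
    intro c a ha
    have hca : c • (a.1 : ℝ → ℝ) =ᵐ[volume] c • (a.2 : ℝ → ℝ) :=
      Filter.EventuallyEq.const_smul
        (show (a.1 : ℝ → ℝ) =ᵐ[volume] (a.2 : ℝ → ℝ) from ha) c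
    exact ((Lp.coeFn_smul c a.1).trans hca).trans (Lp.coeFn_smul c a.2).symm

/-- The Banach space
`F = L^∞ × (L^∞ ∩ L²) × L^∞ × L² × L² × L²` of tuples `Y = (ζ, U, H, v, w, h)`, with the product
topology (the norm is equivalent to the sum of the norms of the components). -/
abbrev F : Type :=
  Lp ℝ ∞ (volume : Measure ℝ) × LinfL2 × Lp ℝ ∞ (volume : Measure ℝ) ×
    Lp ℝ 2 (volume : Measure ℝ) × Lp ℝ 2 (volume : Measure ℝ) × Lp ℝ 2 (volume : Measure ℝ)

namespace F

/-- The component `ζ`. -/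
def ζ (Y : F) : ℝ → ℝ := (Y.1 : ℝ → ℝ)

/-- The component `U`. -/
def U (Y : F) : ℝ → ℝ := (Y.2.1.1.1 : ℝ → ℝ)

/-- The component `H`. -/
def H (Y : F) : ℝ → ℝ := (Y.2.2.1 : ℝ → ℝ)

/-- The component `v`. -/
def v (Y : F) : ℝ → ℝ := (Y.2.2.2.1 : ℝ → ℝ)

/-- The component `w`. -/
def w (Y : F) : ℝ → ℝ := (Y.2.2.2.2.1 : ℝ → ℝ)

/-- The component `h`. -/
def h (Y : F) : ℝ → ℝ := (Y.2.2.2.2.2 : ℝ → ℝ)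

/-- The particle position `y(ξ) = ζ(ξ) + ξ`. -/
def y (Y : F) (ξ : ℝ) : ℝ := Y.ζ ξ + ξ

/-- The variable `q = v + 1`. -/
def q (Y : F) (ξ : ℝ) : ℝ := Y.v ξ + 1

/-- `P = ½ ∫ e^{-sgn(ξ-η)(y(ξ)-y(η))} ((3-2γ)/2 U² q + γ/2 h)(η) dη`. -/
def P (γ : ℝ) (Y : F) (ξ : ℝ) : ℝ :=
  (1 / 2) * ∫ η : ℝ, Real.exp (-(Real.sign (ξ - η) * (Y.y ξ - Y.y η))) *
    ((3 - 2 * γ) / 2 * Y.U η ^ 2 * Y.q η + γ / 2 * Y.h η)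

/-- `Q = -½ ∫ sgn(ξ-η) e^{-sgn(ξ-η)(y(ξ)-y(η))} ((3-2γ)/2 U² q + γ/2 h)(η) dη`. -/
def Q (γ : ℝ) (Y : F) (ξ : ℝ) : ℝ :=
  -(1 / 2) * ∫ η : ℝ, Real.sign (ξ - η) *
    Real.exp (-(Real.sign (ξ - η) * (Y.y ξ - Y.y η))) *
    ((3 - 2 * γ) / 2 * Y.U η ^ 2 * Y.q η + γ / 2 * Y.h η)

end F

/-- `Z = G(Y)`, where `G` is the right-hand side of the system: the components of `Z ∈ F` are,
almost everywhere,
`(γ U, -Q, U³ - 2PU, γ w, γ/2 h + ((3-2γ)/2 U² - P) q, -2QUq + (3U² - 2P) w)`. -/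
structure IsRHS (γ : ℝ) (Y Z : F) : Prop where
  ζ_eq : ∀ᵐ ξ : ℝ, Z.ζ ξ = γ * Y.U ξ
  U_eq : ∀ᵐ ξ : ℝ, Z.U ξ = -Y.Q γ ξ
  H_eq : ∀ᵐ ξ : ℝ, Z.H ξ = Y.U ξ ^ 3 - 2 * Y.P γ ξ * Y.U ξ
  v_eq : ∀ᵐ ξ : ℝ, Z.v ξ = γ * Y.w ξ
  w_eq : ∀ᵐ ξ : ℝ, Z.w ξ =
    γ / 2 * Y.h ξ + ((3 - 2 * γ) / 2 * Y.U ξ ^ 2 - Y.P γ ξ) * Y.q ξ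
  h_eq : ∀ᵐ ξ : ℝ, Z.h ξ =
    -2 * Y.Q γ ξ * Y.U ξ * Y.q ξ + (3 * Y.U ξ ^ 2 - 2 * Y.P γ ξ) * Y.w ξ

/-- `Y ∈ C¹([0,T], F)` is a solution of `Y_t = G(Y)` on `[0,T]`: the curve `Y` has at each
`t ∈ [0,T]` a derivative in `F` (one-sided at the end points), the derivative equals `G(Y(t))` and
is continuous on `[0,T]`. -/
def IsSolution (γ T : ℝ) (Y : ℝ → F) : Prop :=
  ∃ Y' : ℝ → F, ContinuousOn Y' (Icc 0 T) ∧
    ∀ t ∈ Icc 0 T, HasDerivWithinAt Y (Y' t) (Icc 0 T) t ∧ IsRHS γ (Y t) (Y' t)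

/-- `f_ξ = g` for a class `f` of functions modulo null sets: `f` has a locally absolutely continuous
representative, which is differentiable almost everywhere with derivative `g`.  For locally
integrable `f`, `g` this says that `g` is the weak derivative of `f`. -/
def HasSpaceDeriv (f g : ℝ → ℝ) : Prop :=
  ∃ f₀ : ℝ → ℝ, f₀ =ᵐ[volume] f ∧ (∀ a b : ℝ, AbsolutelyContinuousOnInterval f₀ a b) ∧
    ∀ᵐ ξ : ℝ, HasDerivAt f₀ (g ξ) ξ

/-- `q`, `w`, `h` belong to `L^∞(ℝ)`. -/
def BoundedDensities (Y : F) : Prop :=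
  MemLp Y.q ∞ volume ∧ MemLp Y.w ∞ volume ∧ MemLp Y.h ∞ volume

/-- `q h = U² q² + w²` almost everywhere. -/
def EnergyIdentity (Y : F) : Prop :=
  ∀ᵐ ξ : ℝ, Y.q ξ * Y.h ξ = Y.U ξ ^ 2 * Y.q ξ ^ 2 + Y.w ξ ^ 2

/-- `q ≥ 0`, `h ≥ 0` and `q + h ≥ c` almost everywhere, for some constant `c > 0`. -/
def PositiveDensities (Y : F) : Prop :=
  ∃ c : ℝ, 0 < c ∧ ∀ᵐ ξ : ℝ, 0 ≤ Y.q ξ ∧ 0 ≤ Y.h ξ ∧ c ≤ Y.q ξ + Y.h ξ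

/-- `y`, `U`, `H` are differentiable and `y_ξ = q`, `U_ξ = w`, `H_ξ = h`. -/
def DerivativeRelations (Y : F) : Prop :=
  HasSpaceDeriv Y.y Y.q ∧ HasSpaceDeriv Y.U Y.w ∧ HasSpaceDeriv Y.H Y.h

end HyperelasticRod

end

open MeasureTheory Set Filter Topology
open scoped ENNReal

noncomputable section

namespace HyperelasticRod

/-! Once `ζ`, `U` and the source of `P` and `Q` are bounded on `[0,T]` (by compactness), the
densities `(q, w, h)` solve a linear system with bounded `L^∞` coefficients, acting pointwise in
`ξ`. Since `q = v + 1` is not in `L²`, everything is multiplied by the weight `wt`. The system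
commutes with multiplication by any `χ ∈ L^∞`, so Grönwall's inequality holds for the localised
densities with a constant independent of `χ` (`IsSolution.norm_localDensities_sub_le`). Indicators
as `χ` turn this into an a.e. estimate: over a short time step the densities change by at most a
fixed fraction of their size (`IsSolution.exists_step`). Iterating finitely many steps gives
boundedness without solving an ODE for each fixed `ξ`.

The weighted energy defect `qh - U²q² - w²` is a curve in `L¹` whose time derivative cancels
identically. Given the identity, `|w| ≤ (q+h)/2`, so `q + h` stays positive over a short step; as
`qh ≥ 0`, neither factor can become negative.

For the derivative relations, the pairs `(f, wt·f_ξ)` form a closed subspace `derivPairs` of `L^∞ ×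
L²`. For a frozen source the velocity of `(U, w)` is a locally Lipschitz function of `(ζ, v)` which
preserves `derivPairs`, because `Q_ξ = P y_ξ - g`. Hence its quotient norm is bounded by that of
`(ζ, v)` (`norm_mk_UVelocity_le`), and Grönwall in the quotient keeps both classes zero. The
velocity of `(H, h)` then lies in `derivPairs`, so its class is constant. -/

/-- Real-valued `L^∞` classes on the line. -/
abbrev LInf : Type := Lp ℝ ∞ (volume : Measure ℝ)

/-- Real-valued `L²` classes on the line. -/
abbrev L2 : Type := Lp ℝ 2 (volume : Measure ℝ)

/-! ### Products of `Lp` classes -/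

section Products

variable (p q r : ℝ≥0∞) [ENNReal.HolderTriple p q r] [Fact (1 ≤ p)] [Fact (1 ≤ q)] [Fact (1 ≤ r)]

/-- The pointwise product as a continuous bilinear map `L^p × L^q → L^r`. -/
def pmul : Lp ℝ p (volume : Measure ℝ) →L[ℝ] Lp ℝ q (volume : Measure ℝ) →L[ℝ]
    Lp ℝ r (volume : Measure ℝ) :=
  (ContinuousLinearMap.mul ℝ ℝ).holderL volume p q r

variable {p q r}

lemma coeFn_pmul (f : Lp ℝ p (volume : Measure ℝ)) (g : Lp ℝ q (volume : Measure ℝ)) :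
    pmul p q r f g =ᵐ[volume] fun x => f x * g x :=
  (ContinuousLinearMap.mul ℝ ℝ).coeFn_holder f g

lemma norm_pmul_le (f : Lp ℝ p (volume : Measure ℝ)) (g : Lp ℝ q (volume : Measure ℝ)) :
    ‖pmul p q r f g‖ ≤ ‖f‖ * ‖g‖ := by
  refine ((ContinuousLinearMap.mul ℝ ℝ).norm_holder_apply_apply_le f g).trans ?_
  have := ContinuousLinearMap.opNorm_mul_le ℝ ℝ
  calc _ ≤ 1 * ‖f‖ * ‖g‖ := by gcongr
    _ = _ := by ring

end Products

/-! ### Pointwise bounds, `L²` norms and localisation to measurable sets -/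

lemma ae_abs_le_norm (f : LInf) : ∀ᵐ x : ℝ, |f x| ≤ ‖f‖ := by
  filter_upwards [ae_le_eLpNormEssSup (f := (f : ℝ → ℝ)) (μ := volume)] with x hx
  rw [← eLpNorm_exponent_top] at hx
  rw [Lp.norm_def, ← Real.norm_eq_abs, ← toReal_enorm]
  exact ENNReal.toReal_mono (Lp.eLpNorm_ne_top f) hx

lemma norm_le_of_ae_abs_le (f : LInf) {C : ℝ} (hC : 0 ≤ C) (h : ∀ᵐ x : ℝ, |f x| ≤ C) :
    ‖f‖ ≤ C := by
  rw [Lp.norm_def, eLpNorm_exponent_top]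
  exact ENNReal.toReal_le_of_le_ofReal hC (eLpNormEssSup_le_of_ae_bound h)

lemma norm_sq_eq_integral (f : L2) : ‖f‖ ^ 2 = ∫ x, f x ^ 2 := by
  rw [← real_inner_self_eq_norm_sq, L2.inner_def]
  refine integral_congr_ae (Eventually.of_forall fun x => ?_)
  simp [pow_two]

lemma integrable_sq (f : L2) : Integrable (fun x => f x ^ 2) :=
  (Lp.memLp f).integrable_sq

/-- The `L^∞` class of the indicator function of a measurable set. -/
def indInf {S : Set ℝ} (hS : MeasurableSet S) : LInf :=
  MemLp.toLp (S.indicator fun _ => (1 : ℝ)) ((memLp_top_const 1).indicator hS)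

lemma coeFn_indInf {S : Set ℝ} (hS : MeasurableSet S) :
    indInf hS =ᵐ[volume] S.indicator fun _ => (1 : ℝ) :=
  MemLp.coeFn_toLp _

lemma norm_sq_indInf_mul {S : Set ℝ} (hS : MeasurableSet S) (f : L2) :
    ‖pmul ∞ 2 2 (indInf hS) f‖ ^ 2 = ∫ x in S, f x ^ 2 := by
  rw [norm_sq_eq_integral, ← integral_indicator hS]
  refine integral_congr_ae ?_
  filter_upwards [coeFn_pmul (r := 2) (indInf hS) f, coeFn_indInf hS] with x h1 h2
  rw [h1, h2]
  by_cases hx : x ∈ S <;> simp [hx]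

/-- An `L²` estimate which holds after localisation to every measurable set is a pointwise
estimate. -/
lemma ae_abs_le_of_forall_indInf {ε : ℝ} (hε : 0 ≤ ε) (D A B C : L2)
    (h : ∀ (S : Set ℝ) (hS : MeasurableSet S), ‖pmul ∞ 2 2 (indInf hS) D‖ ≤
      ε * ‖(pmul ∞ 2 2 (indInf hS) A, pmul ∞ 2 2 (indInf hS) B, pmul ∞ 2 2 (indInf hS) C)‖) :
    ∀ᵐ x : ℝ, |D x| ≤ ε * (|A x| + |B x| + |C x|) := by
  have hsum : Integrable (fun x => ε ^ 2 * (A x ^ 2 + B x ^ 2 + C x ^ 2)) :=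
    (((integrable_sq A).add (integrable_sq B)).add (integrable_sq C)).const_mul _
  -- Squared norms of localised classes are set integrals, so the hypothesis compares integrals over
  -- every measurable set.
  have key : (fun x => D x ^ 2) ≤ᵐ[volume] fun x => ε ^ 2 * (A x ^ 2 + B x ^ 2 + C x ^ 2) := by
    refine ae_le_of_forall_setIntegral_le (integrable_sq D) hsum fun S hS _ => ?_
    rw [← norm_sq_indInf_mul hS, integral_const_mul, integral_add, integral_add,
      ← norm_sq_indInf_mul hS, ← norm_sq_indInf_mul hS, ← norm_sq_indInf_mul hS]
    · have h1 := h S hS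
      set a := pmul ∞ 2 2 (indInf hS) A
      set b := pmul ∞ 2 2 (indInf hS) B
      set c := pmul ∞ 2 2 (indInf hS) C
      have h2 : ‖(a, b, c)‖ ^ 2 ≤ ‖a‖ ^ 2 + ‖b‖ ^ 2 + ‖c‖ ^ 2 := by
        have h3 : ‖(a, b, c)‖ = max ‖a‖ (max ‖b‖ ‖c‖) := rfl
        rw [h3]
        rcases max_choice ‖a‖ (max ‖b‖ ‖c‖) with h | h <;>
        rcases max_choice ‖b‖ ‖c‖ with h' | h' <;> rw [h] <;> (try rw [h']) <;>
          nlinarith [sq_nonneg ‖a‖, sq_nonneg ‖b‖, sq_nonneg ‖c‖]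
      calc _ ≤ (ε * ‖(a, b, c)‖) ^ 2 := by gcongr
        _ = ε ^ 2 * ‖(a, b, c)‖ ^ 2 := by ring
        _ ≤ _ := by gcongr
    · exact (integrable_sq A).integrableOn
    · exact (integrable_sq B).integrableOn
    · exact ((integrable_sq A).add (integrable_sq B)).integrableOn
    · exact (integrable_sq C).integrableOn
  filter_upwards [key] with x hx
  refine abs_le_of_sq_le_sq' ?_ (by positivity) |> abs_le.mpr
  refine hx.trans ?_
  rw [mul_pow]
  gcongr
  have := abs_nonneg (A x)
  have := abs_nonneg (B x)
  have := abs_nonneg (C x)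
  rw [← sq_abs (A x), ← sq_abs (B x), ← sq_abs (C x)]
  nlinarith [mul_nonneg (abs_nonneg (A x)) (abs_nonneg (B x)),
    mul_nonneg (abs_nonneg (A x)) (abs_nonneg (C x)),
    mul_nonneg (abs_nonneg (B x)) (abs_nonneg (C x))]

/-! ### The weight `(1 + ξ²)⁻¹` -/

/-- A positive weight in `L^∞ ∩ L²`. -/
def wt (x : ℝ) : ℝ := (1 + x ^ 2)⁻¹

lemma wt_pos (x : ℝ) : 0 < wt x := by unfold wt; positivity

lemma wt_le_one (x : ℝ) : wt x ≤ 1 := by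
  unfold wt
  exact inv_le_one_of_one_le₀ (by nlinarith [sq_nonneg x])

lemma continuous_wt : Continuous wt :=
  Continuous.inv₀ (by fun_prop) fun x => by positivity

lemma memLp_wt_top : MemLp wt ∞ (volume : Measure ℝ) :=
  memLp_top_of_bound continuous_wt.aestronglyMeasurable 1
    (Eventually.of_forall fun x => by
      rw [Real.norm_eq_abs, abs_of_pos (wt_pos x)]; exact wt_le_one x)

lemma memLp_wt_two : MemLp wt 2 (volume : Measure ℝ) := by
  rw [memLp_two_iff_integrable_sq continuous_wt.aestronglyMeasurable]
  refine integrable_inv_one_add_sq.mono' (continuous_wt.pow 2).aestronglyMeasurable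
    (Eventually.of_forall fun x => ?_)
  rw [Real.norm_eq_abs, abs_of_nonneg (sq_nonneg _), pow_two]
  exact mul_le_of_le_one_left (wt_pos x).le (wt_le_one x)

/-- The weight as an element of `L^∞`. -/
def wtInf : LInf := memLp_wt_top.toLp wt

/-- The weight as an element of `L²`. -/
def wtTwo : L2 := memLp_wt_two.toLp wt

lemma coeFn_wtInf : wtInf =ᵐ[volume] wt := MemLp.coeFn_toLp _

lemma coeFn_wtTwo : wtTwo =ᵐ[volume] wt := MemLp.coeFn_toLp _

/-! ### The nonlocal terms -/

/-- The integral operator with kernel `σ(ξ-η) e^{-sgn(ξ-η)(y(ξ)-y(η))}`, where `y(ξ) = ζ(ξ) + ξ`. -/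
def kint (σ ζ g : ℝ → ℝ) (ξ : ℝ) : ℝ :=
  ∫ η : ℝ, σ (ξ - η) * Real.exp (-(Real.sign (ξ - η) * (ζ ξ + ξ - (ζ η + η)))) * g η

lemma kint_congr_right (σ ζ : ℝ → ℝ) {g g' : ℝ → ℝ} (h : g =ᵐ[volume] g') :
    kint σ ζ g = kint σ ζ g' := by
  funext ξ
  refine integral_congr_ae ?_
  filter_upwards [h] with η hη
  rw [hη]

lemma measurable_sign : Measurable Real.sign := by
  unfold Real.sign
  exact Measurable.ite measurableSet_Iio measurable_const
    (Measurable.ite measurableSet_Ioi measurable_const measurable_const)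

lemma abs_sign_le_one (x : ℝ) : |Real.sign x| ≤ 1 := by
  rcases Real.sign_apply_eq x with h | h | h <;> simp [h]

lemma sign_mul_self_eq_abs (x : ℝ) : Real.sign x * x = |x| := by
  rcases lt_trichotomy x 0 with h | h | h
  · rw [Real.sign_of_neg h, abs_of_neg h]; ring
  · simp [h]
  · rw [Real.sign_of_pos h, abs_of_pos h]; ring

lemma stronglyMeasurable_kint {σ ζ g : ℝ → ℝ} (hσ : Measurable σ) (hζ : Measurable ζ)
    (hg : Measurable g) : StronglyMeasurable (kint σ ζ g) := by
  refine StronglyMeasurable.integral_prod_right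
    (f := fun ξ η => σ (ξ - η) * Real.exp (-(Real.sign (ξ - η) * (ζ ξ + ξ - (ζ η + η)))) * g η) ?_
  refine Measurable.stronglyMeasurable ?_
  have := measurable_sign
  unfold Function.uncurry
  fun_prop

lemma measurable_coeFn {p : ℝ≥0∞} (f : Lp ℝ p (volume : Measure ℝ)) : Measurable (f : ℝ → ℝ) :=
  (Lp.stronglyMeasurable f).measurable

/-- The part `sgn(ξ-η)(ξ-η) = |ξ-η|` of the exponent gives the decay; the remaining `sgn(ξ-η)(a-b)`
costs at most `2R`. -/
lemma exp_sign_kernel_le {R a b ξ η : ℝ} (ha : |a| ≤ R) (hb : |b| ≤ R) :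
    Real.exp (-(Real.sign (ξ - η) * (a + ξ - (b + η)))) ≤
      Real.exp (2 * R) * Real.exp (-|ξ - η|) := by
  rw [← Real.exp_add, Real.exp_le_exp]
  have h1 : Real.sign (ξ - η) * (a + ξ - (b + η)) = |ξ - η| + Real.sign (ξ - η) * (a - b) := by
    rw [← sign_mul_self_eq_abs]; ring
  have h2 : |Real.sign (ξ - η) * (a - b)| ≤ 1 * (2 * R) := by
    rw [abs_mul]
    refine mul_le_mul (abs_sign_le_one _) ?_ (abs_nonneg _) zero_le_one
    have := abs_sub a b
    linarith
  have := neg_abs_le (Real.sign (ξ - η) * (a - b))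
  linarith

lemma integral_exp_neg_two_abs_sub (ξ : ℝ) :
    Integrable (fun η => Real.exp (-|ξ - η|) ^ 2) ∧ ∫ η, Real.exp (-|ξ - η|) ^ 2 = 1 := by
  have h0 : IntegrableOn (fun x : ℝ => Real.exp (-2 * x)) (Ioi 0) :=
    integrableOn_exp_mul_Ioi (by norm_num) 0
  have e : (fun η => Real.exp (-|ξ - η|) ^ 2) = fun η => Real.exp (-2 * |ξ - η|) := by
    funext η; rw [← Real.exp_nat_mul]; congr 1; push_cast; ring
  rw [e]
  have hI : Integrable (fun x : ℝ => Real.exp (-2 * |x|)) := by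
    rw [← integrableOn_univ, ← Iic_union_Ioi (a := (0 : ℝ))]
    refine IntegrableOn.union ?_ (h0.congr_fun (fun x hx => ?_) measurableSet_Ioi)
    · refine (integrableOn_exp_mul_Iic (by norm_num : (0 : ℝ) < 2) 0).congr_fun
        (fun x hx => ?_) measurableSet_Iic
      simp only [abs_of_nonpos (mem_Iic.1 hx)]
      ring_nf
    · simp only [abs_of_pos (mem_Ioi.1 hx)]
  refine ⟨hI.comp_sub_left ξ, ?_⟩
  rw [integral_sub_left_eq_self (fun x : ℝ => Real.exp (-2 * |x|)) volume ξ,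
    integral_comp_abs (f := fun x => Real.exp (-2 * x)), integral_exp_mul_Ioi (by norm_num)]
  norm_num

lemma memLp_exp_neg_abs_sub (ξ : ℝ) :
    MemLp (fun η => Real.exp (-|ξ - η|)) 2 (volume : Measure ℝ) := by
  rw [memLp_two_iff_integrable_sq (by fun_prop)]
  exact (integral_exp_neg_two_abs_sub ξ).1

lemma integrable_exp_neg_abs_mul (ξ : ℝ) (g : L2) :
    Integrable fun η => Real.exp (-|ξ - η|) * |g η| :=
  (memLp_exp_neg_abs_sub ξ).integrable_mul (Lp.memLp g).abs

/-- Cauchy–Schwarz, with constant one because `η ↦ e^{-|ξ-η|}` has `L²` norm one. -/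
lemma integral_exp_neg_abs_mul_le (ξ : ℝ) (g : L2) :
    ∫ η, Real.exp (-|ξ - η|) * |g η| ≤ ‖g‖ := by
  have h := integral_mul_le_Lp_mul_Lq_of_nonneg (μ := (volume : Measure ℝ))
    (f := fun η => Real.exp (-|ξ - η|)) (g := fun η => |g η|) Real.HolderConjugate.two_two
    (Eventually.of_forall fun _ => (Real.exp_pos _).le)
    (Eventually.of_forall fun _ => abs_nonneg _)
    (by simpa using memLp_exp_neg_abs_sub ξ)
    (by rw [ENNReal.ofReal_ofNat]; exact (Lp.memLp g).abs)
  refine h.trans_eq ?_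
  simp only [Real.rpow_two, sq_abs]
  rw [(integral_exp_neg_two_abs_sub ξ).2, ← norm_sq_eq_integral, ← Real.sqrt_eq_rpow,
    ← Real.sqrt_eq_rpow, Real.sqrt_one, Real.sqrt_sq (norm_nonneg _), one_mul]

/-- The bound at `ξ` itself is assumed because the kernel evaluates the chosen representative of `ζ`
there; it holds for almost every `ξ`. -/
lemma integrable_kernel {σ : ℝ → ℝ} (hσ : Measurable σ) (hσ1 : ∀ x, |σ x| ≤ 1) (ζ : LInf) (g : L2)
    {ξ : ℝ} (hξ : |ζ ξ| ≤ ‖ζ‖) :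
    Integrable fun η => σ (ξ - η) *
      Real.exp (-(Real.sign (ξ - η) * (ζ ξ + ξ - (ζ η + η)))) * g η := by
  have := measurable_sign
  have := measurable_coeFn ζ
  have := measurable_coeFn g
  refine ((integrable_exp_neg_abs_mul ξ g).const_mul (Real.exp (2 * ‖ζ‖))).mono'
    (by fun_prop) ?_
  filter_upwards [ae_abs_le_norm ζ] with η hη
  rw [Real.norm_eq_abs, abs_mul, abs_mul, Real.abs_exp, ← mul_assoc]
  refine mul_le_mul_of_nonneg_right ?_ (abs_nonneg _)
  exact (mul_le_of_le_one_left (Real.exp_pos _).le (hσ1 _)).trans (exp_sign_kernel_le hξ hη)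

lemma abs_kint_le {σ : ℝ → ℝ} (hσ1 : ∀ x, |σ x| ≤ 1) (ζ : LInf) (g : L2)
    {ξ : ℝ} (hξ : |ζ ξ| ≤ ‖ζ‖) : |kint σ ζ g ξ| ≤ Real.exp (2 * ‖ζ‖) * ‖g‖ := by
  rw [← Real.norm_eq_abs]
  refine (norm_integral_le_of_norm_le
    ((integrable_exp_neg_abs_mul ξ g).const_mul (Real.exp (2 * ‖ζ‖))) ?_).trans ?_
  · filter_upwards [ae_abs_le_norm ζ] with η hη
    rw [Real.norm_eq_abs, abs_mul, abs_mul, Real.abs_exp, ← mul_assoc]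
    refine mul_le_mul_of_nonneg_right ?_ (abs_nonneg _)
    exact (mul_le_of_le_one_left (Real.exp_pos _).le (hσ1 _)).trans (exp_sign_kernel_le hξ hη)
  · rw [integral_const_mul]
    exact mul_le_mul_of_nonneg_left (integral_exp_neg_abs_mul_le ξ g) (Real.exp_pos _).le

/-- This follows from `1 + x ≤ e^x`. A bound `M` on the exponentials, rather than on the exponents,
keeps the decay `e^{-|ξ-η|}` when two kernels are subtracted. -/
lemma abs_exp_sub_exp_le {a b M : ℝ} (ha : Real.exp a ≤ M) (hb : Real.exp b ≤ M) :
    |Real.exp a - Real.exp b| ≤ M * |a - b| := by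
  wlog h : b ≤ a generalizing a b
  · rw [abs_sub_comm, abs_sub_comm a]
    exact this hb ha (not_le.1 h).le
  rw [abs_of_nonneg (sub_nonneg.2 (Real.exp_le_exp.2 h)), abs_of_nonneg (sub_nonneg.2 h)]
  have h1 : 1 - (a - b) ≤ Real.exp (b - a) := by
    have := Real.add_one_le_exp (b - a)
    linarith
  have h2 : Real.exp b = Real.exp a * Real.exp (b - a) := by
    rw [← Real.exp_add]; congr 1; ring
  rw [h2]
  calc _ = Real.exp a * (1 - Real.exp (b - a)) := by ring
    _ ≤ Real.exp a * (a - b) :=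
      mul_le_mul_of_nonneg_left (by linarith) (Real.exp_pos _).le
    _ ≤ _ := mul_le_mul_of_nonneg_right ha (sub_nonneg.2 h)

lemma abs_kint_sub_le {σ : ℝ → ℝ} (hσ : Measurable σ) (hσ1 : ∀ x, |σ x| ≤ 1) (ζ ζ' : LInf)
    (g : L2) {R : ℝ} (hR : ‖ζ‖ ≤ R) (hR' : ‖ζ'‖ ≤ R) {ξ : ℝ} (hξ : |ζ ξ| ≤ ‖ζ‖)
    (hξ' : |ζ' ξ| ≤ ‖ζ'‖) (hd : |ζ ξ - ζ' ξ| ≤ ‖ζ - ζ'‖) :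
    |kint σ ζ g ξ - kint σ ζ' g ξ| ≤ Real.exp (2 * R) * (2 * ‖ζ - ζ'‖) * ‖g‖ := by
  unfold kint
  rw [← integral_sub (integrable_kernel hσ hσ1 ζ g hξ) (integrable_kernel hσ hσ1 ζ' g hξ'),
    ← Real.norm_eq_abs]
  refine (norm_integral_le_of_norm_le
    ((integrable_exp_neg_abs_mul ξ g).const_mul (Real.exp (2 * R) * (2 * ‖ζ - ζ'‖))) ?_).trans ?_
  · filter_upwards [ae_abs_le_norm ζ, ae_abs_le_norm ζ', ae_abs_le_norm (ζ - ζ'),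
      Lp.coeFn_sub ζ ζ'] with η h1 h2 h3 h4
    rw [h4, Pi.sub_apply] at h3
    rw [Real.norm_eq_abs, ← sub_mul, ← mul_sub, abs_mul, abs_mul, ← mul_assoc]
    refine mul_le_mul_of_nonneg_right ?_ (abs_nonneg _)
    refine (mul_le_of_le_one_left (abs_nonneg _) (hσ1 _)).trans ?_
    refine (abs_exp_sub_exp_le (exp_sign_kernel_le (hξ.trans hR) (h1.trans hR))
      (exp_sign_kernel_le (hξ'.trans hR') (h2.trans hR'))).trans ?_
    have h5 : |-(Real.sign (ξ - η) * (ζ ξ + ξ - (ζ η + η))) -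
        -(Real.sign (ξ - η) * (ζ' ξ + ξ - (ζ' η + η)))| ≤ 2 * ‖ζ - ζ'‖ := by
      have : -(Real.sign (ξ - η) * (ζ ξ + ξ - (ζ η + η))) -
          -(Real.sign (ξ - η) * (ζ' ξ + ξ - (ζ' η + η))) =
          -Real.sign (ξ - η) * ((ζ ξ - ζ' ξ) - (ζ η - ζ' η)) := by ring
      rw [this, abs_mul, abs_neg]
      refine (mul_le_of_le_one_left (abs_nonneg _) (abs_sign_le_one _)).trans ?_
      exact (abs_sub _ _).trans (by linarith)
    calc _ ≤ Real.exp (2 * R) * Real.exp (-|ξ - η|) * (2 * ‖ζ - ζ'‖) := by gcongr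
      _ = _ := by ring
  · rw [integral_const_mul]
    exact mul_le_mul_of_nonneg_left (integral_exp_neg_abs_mul_le ξ g) (by positivity)

lemma memLp_kint {σ : ℝ → ℝ} (hσ : Measurable σ) (hσ1 : ∀ x, |σ x| ≤ 1) (ζ : LInf) (g : L2) :
    MemLp (kint σ ζ g) ∞ (volume : Measure ℝ) := by
  refine memLp_top_of_bound (stronglyMeasurable_kint hσ (measurable_coeFn ζ)
    (measurable_coeFn g)).aestronglyMeasurable (Real.exp (2 * ‖ζ‖) * ‖g‖) ?_
  filter_upwards [ae_abs_le_norm ζ] with ξ hξ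
  exact abs_kint_le hσ1 ζ g hξ

/-- The nonlocal term `P` as an `L^∞` class, for given `ζ` and source term `g`. -/
def nonlocalP (ζ : LInf) (g : L2) : LInf :=
  (1 / 2 : ℝ) • (memLp_kint measurable_const (σ := fun _ => 1) (by simp) ζ g).toLp _

/-- The nonlocal term `Q` as an `L^∞` class, for given `ζ` and source term `g`. -/
def nonlocalQ (ζ : LInf) (g : L2) : LInf :=
  (-(1 / 2) : ℝ) • (memLp_kint measurable_sign abs_sign_le_one ζ g).toLp _

lemma coeFn_nonlocalP (ζ : LInf) (g : L2) :
    nonlocalP ζ g =ᵐ[volume] fun ξ => 1 / 2 * kint (fun _ => 1) ζ g ξ := by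
  refine (Lp.coeFn_smul _ _).trans ?_
  filter_upwards [MemLp.coeFn_toLp
    (memLp_kint measurable_const (σ := fun _ => 1) (by simp) ζ g)] with ξ hξ
  rw [Pi.smul_apply, hξ, smul_eq_mul]

lemma coeFn_nonlocalQ (ζ : LInf) (g : L2) :
    nonlocalQ ζ g =ᵐ[volume] fun ξ => -(1 / 2) * kint Real.sign ζ g ξ := by
  refine (Lp.coeFn_smul _ _).trans ?_
  filter_upwards [MemLp.coeFn_toLp
    (memLp_kint measurable_sign abs_sign_le_one ζ g)] with ξ hξ
  rw [Pi.smul_apply, hξ, smul_eq_mul]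

lemma norm_nonlocalP_le (ζ : LInf) (g : L2) : ‖nonlocalP ζ g‖ ≤ Real.exp (2 * ‖ζ‖) * ‖g‖ := by
  refine norm_le_of_ae_abs_le _ (by positivity) ?_
  filter_upwards [coeFn_nonlocalP ζ g, ae_abs_le_norm ζ] with ξ h1 h2
  have := abs_kint_le (σ := fun _ => 1) (by simp) ζ g h2
  rw [h1, abs_mul, abs_of_pos (by norm_num : (0 : ℝ) < 1 / 2)]
  linarith [abs_nonneg (kint (fun _ => 1) ζ g ξ)]

lemma norm_nonlocalQ_le (ζ : LInf) (g : L2) : ‖nonlocalQ ζ g‖ ≤ Real.exp (2 * ‖ζ‖) * ‖g‖ := by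
  refine norm_le_of_ae_abs_le _ (by positivity) ?_
  filter_upwards [coeFn_nonlocalQ ζ g, ae_abs_le_norm ζ] with ξ h1 h2
  have := abs_kint_le abs_sign_le_one ζ g h2
  rw [h1, abs_mul, abs_neg, abs_of_pos (by norm_num : (0 : ℝ) < 1 / 2)]
  linarith [abs_nonneg (kint Real.sign ζ g ξ)]

lemma norm_nonlocalP_sub_le (ζ ζ' : LInf) (g : L2) {R : ℝ} (hR : ‖ζ‖ ≤ R) (hR' : ‖ζ'‖ ≤ R) :
    ‖nonlocalP ζ g - nonlocalP ζ' g‖ ≤ Real.exp (2 * R) * ‖g‖ * ‖ζ - ζ'‖ := by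
  refine norm_le_of_ae_abs_le _ (by positivity) ?_
  filter_upwards [Lp.coeFn_sub (nonlocalP ζ g) (nonlocalP ζ' g), coeFn_nonlocalP ζ g,
    coeFn_nonlocalP ζ' g, ae_abs_le_norm ζ, ae_abs_le_norm ζ', ae_abs_le_norm (ζ - ζ'),
    Lp.coeFn_sub ζ ζ'] with ξ h1 h2 h3 h4 h5 h6 h7
  rw [h7, Pi.sub_apply] at h6
  have := abs_kint_sub_le (σ := fun _ => 1) measurable_const (by simp) ζ ζ' g hR hR' h4 h5 h6
  rw [h1, Pi.sub_apply, h2, h3, ← mul_sub, abs_mul, abs_of_pos (by norm_num : (0 : ℝ) < 1 / 2)]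
  linarith

lemma norm_nonlocalQ_sub_le (ζ ζ' : LInf) (g : L2) {R : ℝ} (hR : ‖ζ‖ ≤ R) (hR' : ‖ζ'‖ ≤ R) :
    ‖nonlocalQ ζ g - nonlocalQ ζ' g‖ ≤ Real.exp (2 * R) * ‖g‖ * ‖ζ - ζ'‖ := by
  refine norm_le_of_ae_abs_le _ (by positivity) ?_
  filter_upwards [Lp.coeFn_sub (nonlocalQ ζ g) (nonlocalQ ζ' g), coeFn_nonlocalQ ζ g,
    coeFn_nonlocalQ ζ' g, ae_abs_le_norm ζ, ae_abs_le_norm ζ', ae_abs_le_norm (ζ - ζ'),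
    Lp.coeFn_sub ζ ζ'] with ξ h1 h2 h3 h4 h5 h6 h7
  rw [h7, Pi.sub_apply] at h6
  have := abs_kint_sub_le measurable_sign abs_sign_le_one ζ ζ' g hR hR' h4 h5 h6
  rw [h1, Pi.sub_apply, h2, h3, ← mul_sub, abs_mul, abs_neg,
    abs_of_pos (by norm_num : (0 : ℝ) < 1 / 2)]
  linarith

/-! ### Calculus of locally absolutely continuous classes -/

lemma HasSpaceDeriv.congr {f g f' g' : ℝ → ℝ} (h : HasSpaceDeriv f g) (hf : f =ᵐ[volume] f')
    (hg : g =ᵐ[volume] g') : HasSpaceDeriv f' g' := by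
  obtain ⟨f₀, h1, h2, h3⟩ := h
  refine ⟨f₀, h1.trans hf, h2, ?_⟩
  filter_upwards [h3, hg] with ξ h4 h5
  rwa [← h5]

lemma HasSpaceDeriv.add {f g f' g' : ℝ → ℝ} (h : HasSpaceDeriv f g) (h' : HasSpaceDeriv f' g') :
    HasSpaceDeriv (fun ξ => f ξ + f' ξ) (fun ξ => g ξ + g' ξ) := by
  obtain ⟨f₀, h1, h2, h3⟩ := h
  obtain ⟨f₀', h1', h2', h3'⟩ := h'
  refine ⟨f₀ + f₀', h1.add h1', fun a b => (h2 a b).add (h2' a b), ?_⟩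
  filter_upwards [h3, h3'] with ξ h4 h5
  exact h4.add h5

lemma HasSpaceDeriv.mul {f g f' g' : ℝ → ℝ} (h : HasSpaceDeriv f g) (h' : HasSpaceDeriv f' g') :
    HasSpaceDeriv (fun ξ => f ξ * f' ξ) (fun ξ => g ξ * f' ξ + f ξ * g' ξ) := by
  obtain ⟨f₀, h1, h2, h3⟩ := h
  obtain ⟨f₀', h1', h2', h3'⟩ := h'
  refine ⟨f₀ * f₀', h1.mul h1', fun a b => (h2 a b).mul (h2' a b), ?_⟩
  filter_upwards [h3, h3', h1, h1'] with ξ h4 h5 h6 h7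
  rw [← h6, ← h7]
  exact h4.mul h5

lemma hasSpaceDeriv_const (c : ℝ) : HasSpaceDeriv (fun _ => c) (fun _ => 0) :=
  ⟨fun _ => c, ae_eq_refl _,
    fun _ _ => (LipschitzWith.const c).lipschitzOnWith.absolutelyContinuousOnInterval,
    Eventually.of_forall fun ξ => hasDerivAt_const ξ c⟩

lemma hasSpaceDeriv_id : HasSpaceDeriv (fun ξ => ξ) (fun _ => 1) :=
  ⟨fun ξ => ξ, ae_eq_refl _,
    fun _ _ => LipschitzWith.id.lipschitzOnWith.absolutelyContinuousOnInterval,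
    Eventually.of_forall fun ξ => hasDerivAt_id ξ⟩

lemma HasSpaceDeriv.const_mul {f g : ℝ → ℝ} (c : ℝ) (h : HasSpaceDeriv f g) :
    HasSpaceDeriv (fun ξ => c * f ξ) (fun ξ => c * g ξ) := by
  refine ((hasSpaceDeriv_const c).mul h).congr (ae_eq_refl _) (Eventually.of_forall fun ξ => ?_)
  simp

/-- The exponential of an absolutely continuous function is absolutely continuous. -/
lemma AbsolutelyContinuousOnInterval.exp {f : ℝ → ℝ} {a b : ℝ}
    (hf : AbsolutelyContinuousOnInterval f a b) :
    AbsolutelyContinuousOnInterval (fun x => Real.exp (f x)) a b := by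
  obtain ⟨C, hC⟩ := hf.exists_bound
  rw [absolutelyContinuousOnInterval_iff] at hf ⊢
  intro ε hε
  obtain ⟨δ, hδ, h⟩ := hf (ε / Real.exp C) (by positivity)
  refine ⟨δ, hδ, fun E hE hEδ => ?_⟩
  have h1 := h E hE hEδ
  rw [lt_div_iff₀ (Real.exp_pos C), mul_comm, Finset.mul_sum] at h1
  refine lt_of_le_of_lt (Finset.sum_le_sum fun i hi => ?_) h1
  have hb : ∀ x ∈ uIcc a b, Real.exp (f x) ≤ Real.exp C := fun x hx =>
    Real.exp_le_exp.2 ((le_abs_self _).trans (hC x hx))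
  exact abs_exp_sub_exp_le (hb _ (hE.1 i hi).1) (hb _ (hE.1 i hi).2)

lemma HasSpaceDeriv.exp {f g : ℝ → ℝ} (h : HasSpaceDeriv f g) :
    HasSpaceDeriv (fun ξ => Real.exp (f ξ)) (fun ξ => Real.exp (f ξ) * g ξ) := by
  obtain ⟨f₀, h1, h2, h3⟩ := h
  refine ⟨fun ξ => Real.exp (f₀ ξ), ?_, fun a b => AbsolutelyContinuousOnInterval.exp (h2 a b), ?_⟩
  · filter_upwards [h1] with ξ hξ
    rw [hξ]
  · filter_upwards [h1, h3] with ξ hξ h4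
    rw [← hξ]
    exact h4.exp

lemma hasSpaceDeriv_primitive {g : ℝ → ℝ} (hg : LocallyIntegrable g) (c : ℝ) :
    HasSpaceDeriv (fun ξ => c + ∫ η in (0 : ℝ)..ξ, g η) g := by
  have h : HasSpaceDeriv (fun ξ => ∫ η in (0 : ℝ)..ξ, g η) g := by
    refine ⟨_, ae_eq_refl _, fun a b => ?_, ?_⟩
    -- The interval is enlarged to contain the base point `0` of the primitive, then restricted
    -- back.
    · have h0 : (0 : ℝ) ∈ uIcc (min (min a b) 0) (max (max a b) 0) := by
        rw [mem_uIcc]; left; simp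
      have hi : IntervalIntegrable g volume (min (min a b) 0) (max (max a b) 0) :=
        (hg.integrableOn_isCompact isCompact_uIcc).intervalIntegrable
      refine (hi.absolutelyContinuousOnInterval_intervalIntegral h0).mono ?_
      refine uIcc_subset_uIcc ?_ ?_ <;> rw [mem_uIcc] <;> left <;> simp
    · filter_upwards [_root_.LocallyIntegrable.ae_hasDerivAt_integral hg] with ξ hξ
      exact hξ 0
  exact ((hasSpaceDeriv_const c).add h).congr (ae_eq_refl _)
    (Eventually.of_forall fun ξ => zero_add _)

/-- The fundamental theorem of calculus for absolutely continuous functions. Together with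
`hasSpaceDeriv_primitive` it replaces differentiation by an integral identity, which passes to
limits. -/
lemma HasSpaceDeriv.exists_eq_primitive {f g : ℝ → ℝ} (h : HasSpaceDeriv f g) :
    ∃ c, ∀ᵐ ξ : ℝ, f ξ = c + ∫ η in (0 : ℝ)..ξ, g η := by
  obtain ⟨f₀, h1, h2, h3⟩ := h
  refine ⟨f₀ 0, ?_⟩
  filter_upwards [h1] with ξ hξ
  have h4 := (h2 0 ξ).integral_deriv_eq_sub
  have h5 : ∫ η in (0 : ℝ)..ξ, deriv f₀ η = ∫ η in (0 : ℝ)..ξ, g η := by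
    refine intervalIntegral.integral_congr_ae ?_
    filter_upwards [h3] with η hη _
    exact hη.deriv
  rw [← hξ, ← h5, h4]
  ring

/-! ### The closed subspace of pairs `(f, r)` with `f_ξ = (1 + ξ²) r` -/

lemma continuous_inv_wt : Continuous fun x => (wt x)⁻¹ :=
  continuous_wt.inv₀ fun x => (wt_pos x).ne'

lemma locallyIntegrable_L2 (r : L2) : LocallyIntegrable (r : ℝ → ℝ) :=
  (Lp.memLp r).locallyIntegrable (by norm_num)

lemma locallyIntegrable_inv_wt_mul (r : L2) : LocallyIntegrable fun x => (wt x)⁻¹ * r x :=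
  (locallyIntegrable_L2 r).continuous_mul continuous_inv_wt

/-- The pairs `(f, r)` such that `f` has the derivative `r / wt`. -/
def derivPairs : Submodule ℝ (LInf × L2) where
  carrier := {p | HasSpaceDeriv p.1 fun ξ => (wt ξ)⁻¹ * p.2 ξ}
  zero_mem' := by
    refine (hasSpaceDeriv_const 0).congr (Lp.coeFn_zero ℝ ∞ volume).symm ?_
    filter_upwards [Lp.coeFn_zero ℝ 2 (volume : Measure ℝ)] with ξ hξ
    simp only [Prod.snd_zero, hξ, Pi.zero_apply, mul_zero]
  add_mem' := by
    intro a b ha hb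
    refine (HasSpaceDeriv.add ha hb).congr (Lp.coeFn_add a.1 b.1).symm ?_
    filter_upwards [Lp.coeFn_add a.2 b.2] with ξ hξ
    rw [Prod.snd_add, hξ, Pi.add_apply, mul_add]
  smul_mem' := by
    intro c a ha
    refine (HasSpaceDeriv.const_mul c ha).congr (Lp.coeFn_smul c a.1).symm ?_
    filter_upwards [Lp.coeFn_smul c a.2] with ξ hξ
    rw [Prod.smul_snd, hξ, Pi.smul_apply, smul_eq_mul]
    ring

lemma mem_derivPairs {p : LInf × L2} :
    p ∈ derivPairs ↔ HasSpaceDeriv p.1 fun ξ => (wt ξ)⁻¹ * p.2 ξ := Iff.rfl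

/-- Cauchy–Schwarz on the bounded interval between `0` and `ξ`, where `1 / wt` is bounded; `K`
depends on `ξ`. -/
lemma exists_abs_integral_inv_wt_mul_le (ξ : ℝ) :
    ∃ K, 0 ≤ K ∧ ∀ s : L2, |∫ η in (0 : ℝ)..ξ, (wt η)⁻¹ * s η| ≤ K * ‖s‖ := by
  have hm : MemLp (indicator (uIoc 0 ξ) fun x => (wt x)⁻¹) 2 (volume : Measure ℝ) := by
    rw [memLp_indicator_iff_restrict measurableSet_uIoc]
    obtain ⟨C, hC⟩ := (isCompact_uIcc (a := (0 : ℝ)) (b := ξ)).exists_bound_of_continuousOn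
      continuous_inv_wt.continuousOn
    have : IsFiniteMeasure ((volume : Measure ℝ).restrict (uIoc 0 ξ)) := by
      unfold uIoc; infer_instance
    exact MemLp.of_bound continuous_inv_wt.aestronglyMeasurable C
      (ae_restrict_of_forall_mem measurableSet_uIoc fun x hx => hC x (uIoc_subset_uIcc hx))
  refine ⟨‖hm.toLp _‖, norm_nonneg _, fun s => ?_⟩
  rw [← Real.norm_eq_abs, intervalIntegral.norm_intervalIntegral_eq,
    ← integral_indicator measurableSet_uIoc]
  refine le_trans (le_of_eq ?_) (norm_inner_le_norm (𝕜 := ℝ) (hm.toLp _) s)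
  rw [L2.inner_def]
  congr 1
  refine integral_congr_ae ?_
  filter_upwards [hm.coeFn_toLp] with x hx
  rw [hx]
  by_cases h : x ∈ uIoc 0 ξ <;> simp [h, mul_comm]

lemma isClosed_derivPairs : IsClosed (derivPairs : Set (LInf × L2)) := by
  refine isClosed_of_closure_subset fun p hp => ?_
  have hseq : ∀ n : ℕ, ∃ m : LInf × L2, m ∈ derivPairs ∧ ‖p - m‖ < 1 / (n + 1 : ℝ) := by
    intro n
    obtain ⟨m, hm, h⟩ := Metric.mem_closure_iff.1 hp (1 / (n + 1 : ℝ)) (by positivity)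
    exact ⟨m, hm, by rwa [← dist_eq_norm]⟩
  choose m hm hpm using hseq
  choose c hc using fun n => (mem_derivPairs.1 (hm n)).exists_eq_primitive
  -- The integration constants of the approximating pairs converge, and their limit can be read off
  -- at almost every `ξ`.
  have key : ∀ᵐ ξ : ℝ, Tendsto c atTop
      (𝓝 (p.1 ξ - ∫ η in (0 : ℝ)..ξ, (wt η)⁻¹ * p.2 η)) := by
    filter_upwards [ae_all_iff.2 hc, ae_all_iff.2 fun n => ae_abs_le_norm (p.1 - (m n).1),
      ae_all_iff.2 fun n => Lp.coeFn_sub p.1 (m n).1] with ξ h1 h2 h3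
    obtain ⟨K, hK, h4⟩ := exists_abs_integral_inv_wt_mul_le ξ
    rw [tendsto_iff_dist_tendsto_zero]
    refine squeeze_zero (fun _ => dist_nonneg) (fun n => ?_)
      ?_ (t₀ := atTop) (g := fun n : ℕ => (1 + K) * (1 / (n + 1 : ℝ)))
    rotate_left
    · simpa using (tendsto_one_div_add_atTop_nhds_zero_nat (𝕜 := ℝ)).const_mul (1 + K)
    have h5 := h2 n
    rw [h3 n, Pi.sub_apply, h1 n] at h5
    have h6 : (∫ η in (0 : ℝ)..ξ, (wt η)⁻¹ * p.2 η) - ∫ η in (0 : ℝ)..ξ, (wt η)⁻¹ * (m n).2 η =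
        ∫ η in (0 : ℝ)..ξ, (wt η)⁻¹ * (p.2 - (m n).2 : L2) η := by
      rw [← intervalIntegral.integral_sub]
      · refine intervalIntegral.integral_congr_ae ?_
        filter_upwards [Lp.coeFn_sub p.2 (m n).2] with η hη _
        rw [hη, Pi.sub_apply, mul_sub]
      · exact ((locallyIntegrable_inv_wt_mul _).integrableOn_isCompact
          isCompact_uIcc).intervalIntegrable
      · exact ((locallyIntegrable_inv_wt_mul _).integrableOn_isCompact
          isCompact_uIcc).intervalIntegrable
    have h7 := h4 (p.2 - (m n).2)
    rw [← h6] at h7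
    have h8 : ‖p.1 - (m n).1‖ ≤ 1 / (n + 1 : ℝ) := (norm_fst_le (p - m n)).trans (hpm n).le
    have h9 : ‖p.2 - (m n).2‖ ≤ 1 / (n + 1 : ℝ) := (norm_snd_le (p - m n)).trans (hpm n).le
    have h10 := mul_le_mul_of_nonneg_left h9 hK
    rw [Real.dist_eq, abs_sub_comm]
    set I := ∫ η in (0 : ℝ)..ξ, (wt η)⁻¹ * p.2 η
    set J := ∫ η in (0 : ℝ)..ξ, (wt η)⁻¹ * (m n).2 η
    calc |p.1 ξ - I - c n| = |(p.1 ξ - (c n + J)) - (I - J)| := by ring_nf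
      _ ≤ |p.1 ξ - (c n + J)| + |I - J| := abs_sub _ _
      _ ≤ _ := by linarith
  -- Uniqueness of the limit of `c` makes `p.1 - ∫ p.2 / wt` a.e. equal to its value at one good
  -- point, that is, constant.
  obtain ⟨ξ₀, hξ₀⟩ := key.exists
  refine (hasSpaceDeriv_primitive (locallyIntegrable_inv_wt_mul p.2)
    (p.1 ξ₀ - ∫ η in (0 : ℝ)..ξ₀, (wt η)⁻¹ * p.2 η)).congr ?_ (ae_eq_refl _)
  filter_upwards [key] with ξ hξ
  rw [tendsto_nhds_unique hξ₀ hξ]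
  ring

/-! ### Spatial derivatives of the nonlocal terms -/

/-- A locally absolutely continuous representative is continuous, hence measurable. -/
lemma HasSpaceDeriv.measurable_ae {f g : ℝ → ℝ} (h : HasSpaceDeriv f g) :
    ∃ f₀ : ℝ → ℝ, f₀ =ᵐ[volume] f ∧ Measurable f₀ ∧ HasSpaceDeriv f₀ g := by
  obtain ⟨f₀, h1, h2, h3⟩ := h
  refine ⟨f₀, h1, ?_, f₀, ae_eq_refl _, h2, h3⟩
  refine Continuous.measurable (continuous_iff_continuousAt.2 fun x => ?_)
  refine (h2 (x - 1) (x + 1)).continuousOn.continuousAt ?_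
  rw [uIcc_of_le (by linarith)]
  exact Icc_mem_nhds (by linarith) (by linarith)

section Tails

variable {ζ₀ : ℝ → ℝ} {R : ℝ}

lemma integrableOn_Iic_exp_mul (hm : Measurable ζ₀) (hR : ∀ᵐ η : ℝ, |ζ₀ η| ≤ R) (g : L2) (ξ : ℝ) :
    IntegrableOn (fun η => Real.exp (ζ₀ η + η) * g η) (Iic ξ) := by
  have := measurable_coeFn g
  refine (((integrable_exp_neg_abs_mul ξ g).const_mul (Real.exp (R + ξ))).integrableOn).mono'
    (by fun_prop) ?_
  filter_upwards [ae_restrict_of_ae hR, ae_restrict_mem measurableSet_Iic] with η h1 h2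
  rw [Real.norm_eq_abs, abs_mul, Real.abs_exp, ← mul_assoc, ← Real.exp_add,
    abs_of_nonneg (sub_nonneg.2 (mem_Iic.1 h2))]
  refine mul_le_mul_of_nonneg_right (Real.exp_le_exp.2 ?_) (abs_nonneg _)
  linarith [(abs_le.1 h1).2]

lemma integrableOn_Ioi_exp_mul (hm : Measurable ζ₀) (hR : ∀ᵐ η : ℝ, |ζ₀ η| ≤ R) (g : L2) (ξ : ℝ) :
    IntegrableOn (fun η => Real.exp (-(ζ₀ η + η)) * g η) (Ioi ξ) := by
  have := measurable_coeFn g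
  refine (((integrable_exp_neg_abs_mul ξ g).const_mul (Real.exp (R - ξ))).integrableOn).mono'
    (by fun_prop) ?_
  filter_upwards [ae_restrict_of_ae hR, ae_restrict_mem measurableSet_Ioi] with η h1 h2
  rw [Real.norm_eq_abs, abs_mul, Real.abs_exp, ← mul_assoc, ← Real.exp_add,
    abs_of_neg (sub_neg.2 (mem_Ioi.1 h2))]
  refine mul_le_mul_of_nonneg_right (Real.exp_le_exp.2 ?_) (abs_nonneg _)
  linarith [(abs_le.1 h1).1]

lemma locallyIntegrable_of_Iic {f : ℝ → ℝ} (h : ∀ x, IntegrableOn f (Iic x)) :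
    LocallyIntegrable f := fun x =>
  ⟨Iic (x + 1), Iic_mem_nhds (by linarith), h _⟩

lemma locallyIntegrable_of_Ioi {f : ℝ → ℝ} (h : ∀ x, IntegrableOn f (Ioi x)) :
    LocallyIntegrable f := fun x =>
  ⟨Ioi (x - 1), Ioi_mem_nhds (by linarith), h _⟩

lemma hasSpaceDeriv_integral_Iic {f : ℝ → ℝ} (h : ∀ x, IntegrableOn f (Iic x)) :
    HasSpaceDeriv (fun ξ => ∫ η in Iic ξ, f η) f := by
  refine (hasSpaceDeriv_primitive (locallyIntegrable_of_Iic h) (∫ η in Iic 0, f η)).congr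
    (Eventually.of_forall fun ξ => ?_) (ae_eq_refl _)
  dsimp only
  rw [← intervalIntegral.integral_Iic_sub_Iic (h 0) (h ξ)]
  ring

lemma hasSpaceDeriv_integral_Ioi {f : ℝ → ℝ} (h : ∀ x, IntegrableOn f (Ioi x)) :
    HasSpaceDeriv (fun ξ => ∫ η in Ioi ξ, f η) (fun ξ => -1 * f ξ) := by
  refine (((hasSpaceDeriv_primitive (locallyIntegrable_of_Ioi h)
    (-∫ η in Ioi 0, f η))).const_mul (-1)).congr
    (Eventually.of_forall fun ξ => ?_) (ae_eq_refl _)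
  dsimp only
  rw [← intervalIntegral.integral_interval_add_Ioi (h 0) (h ξ)]
  ring

/-- Splitting of the nonlocal integral at `η = ξ`. -/
lemma kint_eq_add {σ : ℝ → ℝ} {s s' : ℝ} (hs : ∀ x, 0 < x → σ x = s) (hs' : ∀ x, x < 0 → σ x = s')
    {ζ : ℝ → ℝ} (hm : Measurable ζ₀) (hR : ∀ᵐ η : ℝ, |ζ₀ η| ≤ R) (hζ : ζ₀ =ᵐ[volume] ζ) (g : L2)
    {ξ : ℝ} (hξ : ζ₀ ξ = ζ ξ) :
    kint σ ζ g ξ =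
      s * (Real.exp (-(ζ₀ ξ + ξ)) * ∫ η in Iic ξ, Real.exp (ζ₀ η + η) * g η) +
      s' * (Real.exp (ζ₀ ξ + ξ) * ∫ η in Ioi ξ, Real.exp (-(ζ₀ η + η)) * g η) := by
  -- The diagonal is a null set, so the values of `σ` and of the sign at `0` do not matter.
  have hne : ∀ᵐ η : ℝ, η ≠ ξ := by simp [ae_iff]
  have e1 : (fun η => σ (ξ - η) * Real.exp (-(Real.sign (ξ - η) * (ζ ξ + ξ - (ζ η + η)))) * g η)
      =ᵐ[volume.restrict (Iic ξ)]
      fun η => s * (Real.exp (-(ζ₀ ξ + ξ)) * (Real.exp (ζ₀ η + η) * g η)) := by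
    filter_upwards [ae_restrict_of_ae hζ, ae_restrict_of_ae hne,
      ae_restrict_mem measurableSet_Iic] with η h1 h2 h3
    have h4 : 0 < ξ - η := sub_pos.2 (lt_of_le_of_ne h3 h2)
    rw [hs _ h4, Real.sign_of_pos h4, ← hξ, ← h1, ← mul_assoc (Real.exp _) (Real.exp _),
      ← Real.exp_add]
    ring_nf
  have e2 : (fun η => σ (ξ - η) * Real.exp (-(Real.sign (ξ - η) * (ζ ξ + ξ - (ζ η + η)))) * g η)
      =ᵐ[volume.restrict (Ioi ξ)]
      fun η => s' * (Real.exp (ζ₀ ξ + ξ) * (Real.exp (-(ζ₀ η + η)) * g η)) := by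
    filter_upwards [ae_restrict_of_ae hζ, ae_restrict_mem measurableSet_Ioi] with η h1 h3
    have h4 : ξ - η < 0 := sub_neg.2 h3
    rw [hs' _ h4, Real.sign_of_neg h4, ← hξ, ← h1, ← mul_assoc (Real.exp _) (Real.exp _),
      ← Real.exp_add]
    ring_nf
  unfold kint
  rw [← intervalIntegral.integral_Iic_add_Ioi (b := ξ), integral_congr_ae e1, integral_congr_ae e2,
    integral_const_mul, integral_const_mul, integral_const_mul, integral_const_mul]
  · exact (((integrableOn_Iic_exp_mul hm hR g ξ).const_mul _).const_mul _).congr e1.symm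
  · exact (((integrableOn_Ioi_exp_mul hm hR g ξ).const_mul _).const_mul _).congr e2.symm

end Tails

/-- If `ζ_ξ = u`, then `P_ξ = Q (1 + u)` and `Q_ξ = P (1 + u) - g`. -/
lemma hasSpaceDeriv_nonlocal {ζ : LInf} {u : ℝ → ℝ} (h : HasSpaceDeriv ζ u) (g : L2) :
    HasSpaceDeriv (nonlocalP ζ g) (fun ξ => nonlocalQ ζ g ξ * (1 + u ξ)) ∧
    HasSpaceDeriv (nonlocalQ ζ g) (fun ξ => nonlocalP ζ g ξ * (1 + u ξ) - g ξ) := by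
  obtain ⟨ζ₀, h1, hm, h2⟩ := h.measurable_ae
  have hR : ∀ᵐ η : ℝ, |ζ₀ η| ≤ ‖ζ‖ := by
    filter_upwards [h1, ae_abs_le_norm ζ] with η h3 h4
    rwa [h3]
  have hy : HasSpaceDeriv (fun ξ => ζ₀ ξ + ξ) (fun ξ => u ξ + 1) := h2.add hasSpaceDeriv_id
  have hny : HasSpaceDeriv (fun ξ => -(ζ₀ ξ + ξ)) (fun ξ => -(u ξ + 1)) :=
    (hy.const_mul (-1)).congr (Eventually.of_forall fun ξ => by ring)
      (Eventually.of_forall fun ξ => by ring)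
  have hA := hny.exp.mul (hasSpaceDeriv_integral_Iic (integrableOn_Iic_exp_mul hm hR g))
  have hB := hy.exp.mul (hasSpaceDeriv_integral_Ioi (integrableOn_Ioi_exp_mul hm hR g))
  -- The one-sided parts satisfy `A' = -(1+u)A + g` and `B' = (1+u)B - g`. As `P = (A+B)/2` and `Q =
  -- (B-A)/2`, the terms in `g` cancel in `P'` and add up to `-g` in `Q'`.
  set A : ℝ → ℝ := fun ξ => Real.exp (-(ζ₀ ξ + ξ)) * ∫ η in Iic ξ, Real.exp (ζ₀ η + η) * g η
    with hAdef
  set B : ℝ → ℝ := fun ξ => Real.exp (ζ₀ ξ + ξ) * ∫ η in Ioi ξ, Real.exp (-(ζ₀ η + η)) * g η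
    with hBdef
  have hA' : HasSpaceDeriv A (fun ξ => -(1 + u ξ) * A ξ + g ξ) := by
    refine hA.congr (ae_eq_refl _) (Eventually.of_forall fun ξ => ?_)
    have : Real.exp (-(ζ₀ ξ + ξ)) * Real.exp (ζ₀ ξ + ξ) = 1 := by rw [← Real.exp_add]; simp
    simp only [hAdef]
    linear_combination g ξ * this
  have hB' : HasSpaceDeriv B (fun ξ => (1 + u ξ) * B ξ - g ξ) := by
    refine hB.congr (ae_eq_refl _) (Eventually.of_forall fun ξ => ?_)
    have : Real.exp (-(ζ₀ ξ + ξ)) * Real.exp (ζ₀ ξ + ξ) = 1 := by rw [← Real.exp_add]; simp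
    simp only [hBdef]
    linear_combination -g ξ * this
  have eP : ∀ᵐ ξ : ℝ, nonlocalP ζ g ξ = 1 / 2 * A ξ + 1 / 2 * B ξ := by
    filter_upwards [coeFn_nonlocalP ζ g, h1] with ξ h3 h4
    rw [h3, kint_eq_add (s := 1) (s' := 1) (by simp) (by simp) hm hR h1 g h4]
    ring
  have eQ : ∀ᵐ ξ : ℝ, nonlocalQ ζ g ξ = -(1 / 2) * A ξ + 1 / 2 * B ξ := by
    filter_upwards [coeFn_nonlocalQ ζ g, h1] with ξ h3 h4
    rw [h3, kint_eq_add (s := 1) (s' := -1) (fun x hx => Real.sign_of_pos hx)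
      (fun x hx => Real.sign_of_neg hx) hm hR h1 g h4]
    ring
  constructor
  · refine ((hA'.const_mul (1 / 2)).add (hB'.const_mul (1 / 2))).congr ?_ ?_
    · filter_upwards [eP] with ξ h3 using h3.symm
    · filter_upwards [eQ] with ξ h3
      rw [h3]; ring
  · refine ((hA'.const_mul (-(1 / 2))).add (hB'.const_mul (1 / 2))).congr ?_ ?_
    · filter_upwards [eQ] with ξ h3 using h3.symm
    · filter_upwards [eP] with ξ h3
      rw [h3]; ring

/-! ### Linear differential inequalities -/

/-- A curve with `‖f'‖ ≤ K ‖f‖` moves by at most a multiple of its size. -/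
lemma norm_sub_le_of_norm_deriv_le {E : Type*} [NormedAddCommGroup E] [NormedSpace ℝ E]
    {f f' : ℝ → E} {K T : ℝ} (hK : 0 ≤ K)
    (hf : ∀ t ∈ Icc 0 T, HasDerivWithinAt f (f' t) (Icc 0 T) t)
    (hb : ∀ t ∈ Icc 0 T, ‖f' t‖ ≤ K * ‖f t‖) {s t : ℝ} (hs : 0 ≤ s) (hst : s ≤ t) (ht : t ≤ T) :
    ‖f t - f s‖ ≤ K * Real.exp (K * T) * (t - s) * ‖f s‖ := by
  have hsub : Icc s t ⊆ Icc 0 T := Icc_subset_Icc hs ht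
  have hcont : ContinuousOn f (Icc s t) := fun x hx =>
    ((hf x (hsub hx)).continuousWithinAt).mono hsub
  have hd : ∀ x ∈ Ico s t, HasDerivWithinAt f (f' x) (Ici x) x := fun x hx =>
    (hf x (hsub (Ico_subset_Icc_self hx))).mono_of_mem_nhdsWithin
      (Icc_mem_nhdsGE_of_mem ⟨hs.trans hx.1, hx.2.trans_le ht⟩)
  -- Grönwall first bounds the size of `f` on `[s,t]` by its size at `s`; the mean value inequality
  -- then gains the factor `t - s`.
  have h1 := norm_le_gronwallBound_of_norm_deriv_right_le (δ := ‖f s‖) (K := K) (ε := 0) hcont hd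
    le_rfl fun x hx => by simpa using hb x (hsub (Ico_subset_Icc_self hx))
  have h2 := norm_image_sub_le_of_norm_deriv_right_le_segment hcont hd
    (C := K * (‖f s‖ * Real.exp (K * T))) (fun x hx => by
      refine (hb x (hsub (Ico_subset_Icc_self hx))).trans (mul_le_mul_of_nonneg_left ?_ hK)
      refine (h1 x (Ico_subset_Icc_self hx)).trans ?_
      rw [gronwallBound_ε0]
      gcongr
      linarith [hx.2]) t (right_mem_Icc.2 hst)
  linarith

/-- Propagation of a property along an interval by steps of a fixed length. -/
lemma forall_Icc_of_step {Φ : ℝ → Prop} {T δ : ℝ} (hδ : 0 < δ) (h0 : Φ 0)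
    (hstep : ∀ s t, 0 ≤ s → s ≤ t → t ≤ T → t ≤ s + δ → Φ s → Φ t) : ∀ t ∈ Icc 0 T, Φ t := by
  have h : ∀ n : ℕ, ∀ t, 0 ≤ t → t ≤ T → t ≤ n * δ → Φ t := by
    intro n
    induction n with
    | zero =>
      intro t h1 _ h3
      have : t = 0 := le_antisymm (by simpa using h3) h1
      rwa [this]
    | succ n ih =>
      intro t h1 h2 h3
      push_cast at h3
      rcases le_total t δ with h | h
      · exact hstep 0 t le_rfl h1 h2 (by linarith) h0
      · exact hstep (t - δ) t (by linarith) (by linarith) h2 (by linarith)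
          (ih _ (by linarith) (by linarith) (by linarith))
  intro t ht
  obtain ⟨n, hn⟩ := exists_nat_ge (t / δ)
  exact h n t ht.1 ht.2 ((div_le_iff₀ hδ).1 hn)

/-! ### Components and the right-hand side as `Lp` classes -/

namespace F

/-- The component `ζ` as an `L^∞` class. -/
def ζC : F →L[ℝ] LInf := ContinuousLinearMap.fst ℝ _ _

/-- The component `U` as an `L^∞` class. -/
def UC : F →L[ℝ] LInf :=
  ContinuousLinearMap.fst ℝ _ _ ∘L LinfL2.subtypeL ∘L ContinuousLinearMap.fst ℝ _ _ ∘L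
    ContinuousLinearMap.snd ℝ _ _

/-- The component `U` as an `L²` class. -/
def UC₂ : F →L[ℝ] L2 :=
  ContinuousLinearMap.snd ℝ _ _ ∘L LinfL2.subtypeL ∘L ContinuousLinearMap.fst ℝ _ _ ∘L
    ContinuousLinearMap.snd ℝ _ _

/-- The component `H` as an `L^∞` class. -/
def HC : F →L[ℝ] LInf :=
  ContinuousLinearMap.fst ℝ _ _ ∘L ContinuousLinearMap.snd ℝ _ _ ∘L ContinuousLinearMap.snd ℝ _ _

/-- The component `v` as an `L²` class. -/
def vC : F →L[ℝ] L2 :=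
  ContinuousLinearMap.fst ℝ _ _ ∘L ContinuousLinearMap.snd ℝ _ _ ∘L
    ContinuousLinearMap.snd ℝ _ _ ∘L ContinuousLinearMap.snd ℝ _ _

/-- The component `w` as an `L²` class. -/
def wC : F →L[ℝ] L2 :=
  ContinuousLinearMap.fst ℝ _ _ ∘L ContinuousLinearMap.snd ℝ _ _ ∘L
    ContinuousLinearMap.snd ℝ _ _ ∘L ContinuousLinearMap.snd ℝ _ _ ∘L ContinuousLinearMap.snd ℝ _ _

/-- The component `h` as an `L²` class. -/
def hC : F →L[ℝ] L2 :=
  ContinuousLinearMap.snd ℝ _ _ ∘L ContinuousLinearMap.snd ℝ _ _ ∘L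
    ContinuousLinearMap.snd ℝ _ _ ∘L ContinuousLinearMap.snd ℝ _ _ ∘L ContinuousLinearMap.snd ℝ _ _

lemma coeFn_ζC (Y : F) : (ζC Y : ℝ → ℝ) = Y.ζ := rfl
lemma coeFn_UC (Y : F) : (UC Y : ℝ → ℝ) = Y.U := rfl
lemma coeFn_HC (Y : F) : (HC Y : ℝ → ℝ) = Y.H := rfl
lemma coeFn_vC (Y : F) : (vC Y : ℝ → ℝ) = Y.v := rfl
lemma coeFn_wC (Y : F) : (wC Y : ℝ → ℝ) = Y.w := rfl
lemma coeFn_hC (Y : F) : (hC Y : ℝ → ℝ) = Y.h := rfl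

lemma coeFn_UC₂ (Y : F) : UC₂ Y =ᵐ[volume] Y.U := Filter.EventuallyEq.symm Y.2.1.2

/-- The source term `(3-2γ)/2 U² q + γ/2 h` as an `L²` class. -/
def source (γ : ℝ) (Y : F) : L2 :=
  -- As `q = v + 1`, the term `U²q` is `U²v + U·U`; the last product is in `L²` because one factor
  -- is read in `L²`.
  ((3 - 2 * γ) / 2) • (pmul ∞ 2 2 (pmul ∞ ∞ ∞ (UC Y) (UC Y)) (vC Y) + pmul ∞ 2 2 (UC Y) (UC₂ Y)) +
    (γ / 2) • hC Y

lemma coeFn_source (γ : ℝ) (Y : F) : source γ Y =ᵐ[volume] fun ξ =>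
    (3 - 2 * γ) / 2 * Y.U ξ ^ 2 * Y.q ξ + γ / 2 * Y.h ξ := by
  unfold source
  filter_upwards [Lp.coeFn_add (((3 - 2 * γ) / 2) •
      (pmul ∞ 2 2 (pmul ∞ ∞ ∞ (UC Y) (UC Y)) (vC Y) + pmul ∞ 2 2 (UC Y) (UC₂ Y))) ((γ / 2) • hC Y),
    Lp.coeFn_smul ((3 - 2 * γ) / 2)
      (pmul ∞ 2 2 (pmul ∞ ∞ ∞ (UC Y) (UC Y)) (vC Y) + pmul ∞ 2 2 (UC Y) (UC₂ Y)),
    Lp.coeFn_add (pmul ∞ 2 2 (pmul ∞ ∞ ∞ (UC Y) (UC Y)) (vC Y)) (pmul ∞ 2 2 (UC Y) (UC₂ Y)),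
    coeFn_pmul (r := 2) (pmul ∞ ∞ ∞ (UC Y) (UC Y)) (vC Y), coeFn_pmul (r := ∞) (UC Y) (UC Y),
    coeFn_pmul (r := 2) (UC Y) (UC₂ Y), coeFn_UC₂ Y, Lp.coeFn_smul (γ / 2) (hC Y)]
    with ξ h1 h2 h3 h4 h5 h6 h7 h8
  rw [h1, Pi.add_apply, h2, Pi.smul_apply, h3, Pi.add_apply, h4, h5, h6, h7, h8, Pi.smul_apply,
    smul_eq_mul, smul_eq_mul, coeFn_UC, coeFn_vC, coeFn_hC]
  unfold q
  ring

/-- `P` as an `L^∞` class. -/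
def PC (γ : ℝ) (Y : F) : LInf := nonlocalP (ζC Y) (source γ Y)

/-- `Q` as an `L^∞` class. -/
def QC (γ : ℝ) (Y : F) : LInf := nonlocalQ (ζC Y) (source γ Y)

lemma coeFn_PC (γ : ℝ) (Y : F) : PC γ Y =ᵐ[volume] Y.P γ := by
  refine (coeFn_nonlocalP _ _).trans (Eventually.of_forall fun ξ => ?_)
  dsimp only
  rw [kint_congr_right _ _ (coeFn_source γ Y)]
  unfold P kint
  simp only [one_mul]
  rfl

lemma coeFn_QC (γ : ℝ) (Y : F) : QC γ Y =ᵐ[volume] Y.Q γ := by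
  refine (coeFn_nonlocalQ _ _).trans (Eventually.of_forall fun ξ => ?_)
  dsimp only
  rw [kint_congr_right _ _ (coeFn_source γ Y)]
  rfl

/-- The weighted density `q` as an `L²` class. -/
def wtq (Y : F) : L2 := pmul ∞ 2 2 wtInf (vC Y) + wtTwo

/-- The weighted density `w` as an `L²` class. -/
def wtw (Y : F) : L2 := pmul ∞ 2 2 wtInf (wC Y)

/-- The weighted density `h` as an `L²` class. -/
def wth (Y : F) : L2 := pmul ∞ 2 2 wtInf (hC Y)

lemma coeFn_wt_mul (f : L2) : pmul ∞ 2 2 wtInf f =ᵐ[volume] fun ξ => wt ξ * f ξ := by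
  filter_upwards [coeFn_pmul (r := 2) wtInf f, coeFn_wtInf] with ξ h1 h2
  rw [h1, h2]

lemma coeFn_wtq (Y : F) : wtq Y =ᵐ[volume] fun ξ => wt ξ * Y.q ξ := by
  filter_upwards [Lp.coeFn_add (pmul ∞ 2 2 wtInf (vC Y)) wtTwo, coeFn_wt_mul (vC Y), coeFn_wtTwo]
    with ξ h1 h2 h3
  rw [wtq, h1, Pi.add_apply, h2, h3, coeFn_vC]
  unfold q
  ring

lemma coeFn_wtw (Y : F) : wtw Y =ᵐ[volume] fun ξ => wt ξ * Y.w ξ := coeFn_wt_mul _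

lemma coeFn_wth (Y : F) : wth Y =ᵐ[volume] fun ξ => wt ξ * Y.h ξ := coeFn_wt_mul _

/-- The coefficient of `q` in `w_t`. -/
def coefWQ (γ : ℝ) (Y : F) : LInf := ((3 - 2 * γ) / 2) • pmul ∞ ∞ ∞ (UC Y) (UC Y) - PC γ Y

/-- The coefficient of `q` in `h_t`. -/
def coefHQ (γ : ℝ) (Y : F) : LInf := (-2 : ℝ) • pmul ∞ ∞ ∞ (QC γ Y) (UC Y)

/-- The coefficient of `w` in `h_t`. -/
def coefHW (γ : ℝ) (Y : F) : LInf := (3 : ℝ) • pmul ∞ ∞ ∞ (UC Y) (UC Y) - (2 : ℝ) • PC γ Y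

lemma coeFn_coefWQ (γ : ℝ) (Y : F) :
    coefWQ γ Y =ᵐ[volume] fun ξ => (3 - 2 * γ) / 2 * Y.U ξ ^ 2 - Y.P γ ξ := by
  filter_upwards [Lp.coeFn_sub (((3 - 2 * γ) / 2) • pmul ∞ ∞ ∞ (UC Y) (UC Y)) (PC γ Y),
    Lp.coeFn_smul ((3 - 2 * γ) / 2) (pmul ∞ ∞ ∞ (UC Y) (UC Y)),
    coeFn_pmul (r := ∞) (UC Y) (UC Y), coeFn_PC γ Y] with ξ h1 h2 h3 h4
  rw [coefWQ, h1, Pi.sub_apply, h2, Pi.smul_apply, h3, h4, coeFn_UC, smul_eq_mul]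
  ring

lemma coeFn_coefHQ (γ : ℝ) (Y : F) :
    coefHQ γ Y =ᵐ[volume] fun ξ => -2 * Y.Q γ ξ * Y.U ξ := by
  filter_upwards [Lp.coeFn_smul (-2 : ℝ) (pmul ∞ ∞ ∞ (QC γ Y) (UC Y)),
    coeFn_pmul (r := ∞) (QC γ Y) (UC Y), coeFn_QC γ Y] with ξ h2 h3 h4
  rw [coefHQ, h2, Pi.smul_apply, h3, h4, coeFn_UC, smul_eq_mul]
  ring

lemma coeFn_coefHW (γ : ℝ) (Y : F) :
    coefHW γ Y =ᵐ[volume] fun ξ => 3 * Y.U ξ ^ 2 - 2 * Y.P γ ξ := by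
  filter_upwards [Lp.coeFn_sub ((3 : ℝ) • pmul ∞ ∞ ∞ (UC Y) (UC Y)) ((2 : ℝ) • PC γ Y),
    Lp.coeFn_smul (3 : ℝ) (pmul ∞ ∞ ∞ (UC Y) (UC Y)), Lp.coeFn_smul (2 : ℝ) (PC γ Y),
    coeFn_pmul (r := ∞) (UC Y) (UC Y), coeFn_PC γ Y] with ξ h1 h2 h5 h3 h4
  rw [coefHW, h1, Pi.sub_apply, h2, Pi.smul_apply, h3, h5, Pi.smul_apply, h4, coeFn_UC,
    smul_eq_mul, smul_eq_mul]
  ring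

end F

open F

/-! ### The equations of motion as identities between `Lp` classes -/

lemma IsRHS.ζC_eq {γ : ℝ} {Y Z : F} (h : IsRHS γ Y Z) : ζC Z = γ • UC Y := by
  refine Lp.ext ?_
  filter_upwards [h.ζ_eq, Lp.coeFn_smul γ (UC Y)] with ξ h1 h2
  rw [coeFn_ζC, h1, h2, Pi.smul_apply, coeFn_UC, smul_eq_mul]

lemma IsRHS.UC_eq {γ : ℝ} {Y Z : F} (h : IsRHS γ Y Z) : UC Z = -QC γ Y := by
  refine Lp.ext ?_
  filter_upwards [h.U_eq, Lp.coeFn_neg (QC γ Y), coeFn_QC γ Y] with ξ h1 h2 h3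
  rw [coeFn_UC, h1, h2, Pi.neg_apply, h3]

lemma IsRHS.wt_vC_eq {γ : ℝ} {Y Z : F} (h : IsRHS γ Y Z) :
    pmul ∞ 2 2 wtInf (vC Z) = γ • wtw Y := by
  refine Lp.ext ?_
  filter_upwards [h.v_eq, Lp.coeFn_smul γ (wtw Y), coeFn_wtw Y, coeFn_wt_mul (vC Z)]
    with ξ h1 h2 h3 h4
  rw [h4, coeFn_vC, h1, h2, Pi.smul_apply, h3, smul_eq_mul]
  ring

lemma IsRHS.wt_wC_eq {γ : ℝ} {Y Z : F} (h : IsRHS γ Y Z) :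
    pmul ∞ 2 2 wtInf (wC Z) = pmul ∞ 2 2 (coefWQ γ Y) (wtq Y) + (γ / 2) • wth Y := by
  refine Lp.ext ?_
  filter_upwards [h.w_eq, Lp.coeFn_add (pmul ∞ 2 2 (coefWQ γ Y) (wtq Y)) ((γ / 2) • wth Y),
    Lp.coeFn_smul (γ / 2) (wth Y), coeFn_wth Y, coeFn_wtq Y,
    coeFn_pmul (r := 2) (coefWQ γ Y) (wtq Y), coeFn_coefWQ γ Y, coeFn_wt_mul (wC Z)]
    with ξ h1 h2 h3 h4 h5 h6 h7 h8
  rw [h8, coeFn_wC, h1, h2, Pi.add_apply, h3, Pi.smul_apply, h4, h6, h5, h7, smul_eq_mul]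
  ring

lemma IsRHS.wt_hC_eq {γ : ℝ} {Y Z : F} (h : IsRHS γ Y Z) :
    pmul ∞ 2 2 wtInf (hC Z) =
      pmul ∞ 2 2 (coefHQ γ Y) (wtq Y) + pmul ∞ 2 2 (coefHW γ Y) (wtw Y) := by
  refine Lp.ext ?_
  filter_upwards [h.h_eq, Lp.coeFn_add (pmul ∞ 2 2 (coefHQ γ Y) (wtq Y))
      (pmul ∞ 2 2 (coefHW γ Y) (wtw Y)), coeFn_wtw Y, coeFn_wtq Y,
    coeFn_pmul (r := 2) (coefHQ γ Y) (wtq Y), coeFn_pmul (r := 2) (coefHW γ Y) (wtw Y),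
    coeFn_coefHQ γ Y, coeFn_coefHW γ Y, coeFn_wt_mul (hC Z)] with ξ h1 h2 h3 h4 h5 h6 h7 h8 h9
  rw [h9, coeFn_hC, h1, h2, Pi.add_apply, h5, h6, h3, h4, h7, h8]
  ring

/-! ### Time derivatives of the weighted densities and uniform bounds -/

lemma hasDerivWithinAt_wtq {Y : ℝ → F} {Z : F} {s : Set ℝ} {t : ℝ}
    (h : HasDerivWithinAt Y Z s t) :
    HasDerivWithinAt (fun t => wtq (Y t)) (pmul ∞ 2 2 wtInf (vC Z)) s t :=
  (((pmul ∞ 2 2 wtInf ∘L vC).hasFDerivAt.comp_hasDerivWithinAt t h)).add_const _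

lemma hasDerivWithinAt_wtw {Y : ℝ → F} {Z : F} {s : Set ℝ} {t : ℝ}
    (h : HasDerivWithinAt Y Z s t) :
    HasDerivWithinAt (fun t => wtw (Y t)) (pmul ∞ 2 2 wtInf (wC Z)) s t :=
  (pmul ∞ 2 2 wtInf ∘L wC).hasFDerivAt.comp_hasDerivWithinAt t h

lemma hasDerivWithinAt_wth {Y : ℝ → F} {Z : F} {s : Set ℝ} {t : ℝ}
    (h : HasDerivWithinAt Y Z s t) :
    HasDerivWithinAt (fun t => wth (Y t)) (pmul ∞ 2 2 wtInf (hC Z)) s t :=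
  (pmul ∞ 2 2 wtInf ∘L hC).hasFDerivAt.comp_hasDerivWithinAt t h

lemma continuous_source (γ : ℝ) : Continuous (source γ) := by
  unfold source
  fun_prop

lemma IsSolution.continuousOn {γ T : ℝ} {Y : ℝ → F} (hY : IsSolution γ T Y) :
    ContinuousOn Y (Icc 0 T) := by
  obtain ⟨Y', -, h⟩ := hY
  exact fun t ht => (h t ht).1.continuousWithinAt

/-- Bounds for the quantities which enter the coefficients, uniformly in time. -/
lemma IsSolution.exists_bound {γ T : ℝ} {Y : ℝ → F} (hY : IsSolution γ T Y) :
    ∃ R, 0 ≤ R ∧ ∀ t ∈ Icc 0 T, ‖ζC (Y t)‖ ≤ R ∧ ‖UC (Y t)‖ ≤ R ∧ ‖source γ (Y t)‖ ≤ R ∧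
      ‖wtq (Y t)‖ ≤ R := by
  have hc : ContinuousOn (fun t => (ζC (Y t), UC (Y t), source γ (Y t), wtq (Y t))) (Icc 0 T) := by
    have h : Continuous fun Z : F => (ζC Z, UC Z, source γ Z, wtq Z) := by
      have := continuous_source γ
      unfold wtq
      fun_prop
    exact h.comp_continuousOn hY.continuousOn
  obtain ⟨R, hR⟩ := isCompact_Icc.exists_bound_of_continuousOn hc
  refine ⟨max R 0, le_max_right _ _, fun t ht => ?_⟩
  have h := (hR t ht).trans (le_max_left R 0)
  simp only [Prod.norm_def, sup_le_iff] at h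
  exact ⟨h.1, h.2.1, h.2.2.1, h.2.2.2⟩


/-! ### The linear system for `(q, w, h)` -/

lemma norm_PC_le {γ R : ℝ} {Y : F} (h1 : ‖ζC Y‖ ≤ R) (h2 : ‖source γ Y‖ ≤ R) :
    ‖PC γ Y‖ ≤ Real.exp (2 * R) * R :=
  (norm_nonlocalP_le _ _).trans (by gcongr)

lemma norm_QC_le {γ R : ℝ} {Y : F} (h1 : ‖ζC Y‖ ≤ R) (h2 : ‖source γ Y‖ ≤ R) :
    ‖QC γ Y‖ ≤ Real.exp (2 * R) * R :=
  (norm_nonlocalQ_le _ _).trans (by gcongr)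

/-- `P` and `Q` are controlled by `ζ` and the `L²` norm of the source, so no `L^∞` bound on the
densities is needed. -/
lemma IsSolution.exists_coef_bound {γ T : ℝ} {Y : ℝ → F} (hY : IsSolution γ T Y) :
    ∃ K, 0 ≤ K ∧ |γ| ≤ K ∧ ∀ t ∈ Icc 0 T,
      ‖coefWQ γ (Y t)‖ ≤ K ∧ ‖coefHQ γ (Y t)‖ ≤ K ∧ ‖coefHW γ (Y t)‖ ≤ K := by
  obtain ⟨R, hR, h⟩ := hY.exists_bound
  set p := Real.exp (2 * R) * R
  have hp : 0 ≤ p := by positivity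
  refine ⟨|γ| + |(3 - 2 * γ) / 2| * (R * R) + 3 * (R * R) + 2 * (p * R) + 2 * p, by positivity,
    by have : 0 ≤ |(3 - 2 * γ) / 2| * (R * R) + 3 * (R * R) + 2 * (p * R) + 2 * p := by positivity
       linarith, fun t ht => ?_⟩
  obtain ⟨h1, h2, h3, -⟩ := h t ht
  have hP : ‖PC γ (Y t)‖ ≤ p := norm_PC_le h1 h3
  have hQ : ‖QC γ (Y t)‖ ≤ p := norm_QC_le h1 h3
  have hUU : ‖pmul ∞ ∞ ∞ (UC (Y t)) (UC (Y t))‖ ≤ R * R := (norm_pmul_le _ _).trans (by gcongr)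
  have hQU : ‖pmul ∞ ∞ ∞ (QC γ (Y t)) (UC (Y t))‖ ≤ p * R := (norm_pmul_le _ _).trans (by gcongr)
  have a1 : 0 ≤ |γ| := abs_nonneg _
  have a2 : 0 ≤ |(3 - 2 * γ) / 2| * (R * R) := by positivity
  have a3 : 0 ≤ R * R := by positivity
  have a4 : 0 ≤ p * R := by positivity
  refine ⟨?_, ?_, ?_⟩
  · refine (norm_sub_le _ _).trans ?_
    rw [norm_smul, Real.norm_eq_abs]
    have := mul_le_mul_of_nonneg_left hUU (abs_nonneg ((3 - 2 * γ) / 2))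
    linarith
  · rw [coefHQ, norm_smul, Real.norm_eq_abs, abs_neg, abs_two]
    linarith
  · refine (norm_sub_le _ _).trans ?_
    rw [norm_smul, norm_smul, Real.norm_eq_abs, Real.norm_eq_abs, abs_two,
      abs_of_pos (by norm_num : (0 : ℝ) < 3)]
    linarith

/-- Cut-offs commute with the coefficients; this is what makes the linear system local in `ξ`. -/
lemma pmul_left_comm (a b : LInf) (f : L2) :
    pmul ∞ 2 2 a (pmul ∞ 2 2 b f) = pmul ∞ 2 2 b (pmul ∞ 2 2 a f) := by
  refine Lp.ext ?_
  filter_upwards [coeFn_pmul (r := 2) a (pmul ∞ 2 2 b f), coeFn_pmul (r := 2) b f,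
    coeFn_pmul (r := 2) b (pmul ∞ 2 2 a f), coeFn_pmul (r := 2) a f] with x h1 h2 h3 h4
  rw [h1, h2, h3, h4]
  ring

/-- The weighted densities, localised by a factor `χ`. -/
def localDensities (χ : LInf) (Y : F) : L2 × L2 × L2 :=
  (pmul ∞ 2 2 χ (wtq Y), pmul ∞ 2 2 χ (wtw Y), pmul ∞ 2 2 χ (wth Y))

/-- Multiplying the system by `χ` leaves its coefficients unchanged, so one constant `K` serves
every `χ`. This uniformity is what yields pointwise information. -/
lemma IsSolution.norm_localDensities_sub_le {γ T : ℝ} {Y : ℝ → F} (hY : IsSolution γ T Y) :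
    ∃ K, 0 ≤ K ∧ ∀ (χ : LInf) (s t : ℝ), 0 ≤ s → s ≤ t → t ≤ T →
      ‖localDensities χ (Y t) - localDensities χ (Y s)‖ ≤
        K * (t - s) * ‖localDensities χ (Y s)‖ := by
  obtain ⟨K, hK, hγ, hc⟩ := hY.exists_coef_bound
  obtain ⟨Y', -, hd⟩ := hY
  -- Each component of the velocity is a sum of at most two terms, each bounded by the coefficient
  -- bound times the norm: the rate is `2 * K`.
  refine ⟨2 * K * Real.exp (2 * K * T), by positivity, fun χ s t hs hst ht => ?_⟩
  refine norm_sub_le_of_norm_deriv_le (f := fun t => localDensities χ (Y t))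
    (f' := fun t => (pmul ∞ 2 2 χ (pmul ∞ 2 2 wtInf (vC (Y' t))),
      pmul ∞ 2 2 χ (pmul ∞ 2 2 wtInf (wC (Y' t))), pmul ∞ 2 2 χ (pmul ∞ 2 2 wtInf (hC (Y' t)))))
    (by positivity) (fun τ hτ => ?_) (fun τ hτ => ?_) hs hst ht
  · have h := (hd τ hτ).1
    exact ((pmul ∞ 2 2 χ).hasFDerivAt.comp_hasDerivWithinAt τ (hasDerivWithinAt_wtq h)).prodMk
      (((pmul ∞ 2 2 χ).hasFDerivAt.comp_hasDerivWithinAt τ (hasDerivWithinAt_wtw h)).prodMk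
        ((pmul ∞ 2 2 χ).hasFDerivAt.comp_hasDerivWithinAt τ (hasDerivWithinAt_wth h)))
  · have hr := (hd τ hτ).2
    obtain ⟨c1, c2, c3⟩ := hc τ hτ
    rw [hr.wt_vC_eq, hr.wt_wC_eq, hr.wt_hC_eq, map_smul, map_add, map_add, map_smul,
      pmul_left_comm χ, pmul_left_comm χ, pmul_left_comm χ]
    have n1 : ‖pmul ∞ 2 2 χ (wtq (Y τ))‖ ≤ ‖localDensities χ (Y τ)‖ := norm_fst_le (localDensities χ (Y τ))
    have n2 : ‖pmul ∞ 2 2 χ (wtw (Y τ))‖ ≤ ‖localDensities χ (Y τ)‖ :=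
      (norm_fst_le _).trans (norm_snd_le (localDensities χ (Y τ)))
    have n3 : ‖pmul ∞ 2 2 χ (wth (Y τ))‖ ≤ ‖localDensities χ (Y τ)‖ :=
      (norm_snd_le _).trans (norm_snd_le (localDensities χ (Y τ)))
    set N := ‖localDensities χ (Y τ)‖
    have hN : 0 ≤ N := norm_nonneg _
    have hKN : 0 ≤ K * N := by positivity
    simp only [Prod.norm_def, sup_le_iff]
    refine ⟨?_, ?_, ?_⟩
    · rw [norm_smul, Real.norm_eq_abs]
      calc _ ≤ K * N := by gcongr
        _ ≤ _ := by linarith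
    · refine (norm_add_le _ _).trans ?_
      rw [norm_smul, Real.norm_eq_abs]
      have e1 : |γ / 2| ≤ K := by
        rw [abs_div, abs_two]; linarith [abs_nonneg γ]
      calc _ ≤ K * N + K * N :=
            add_le_add ((norm_pmul_le _ _).trans (by gcongr)) (by gcongr)
        _ = _ := by ring
    · refine (norm_add_le _ _).trans ?_
      calc _ ≤ K * N + K * N := add_le_add ((norm_pmul_le _ _).trans (by gcongr))
            ((norm_pmul_le _ _).trans (by gcongr))
        _ = _ := by ring

/-- Over short times, the densities change almost everywhere by a small fraction of their size. -/
lemma IsSolution.exists_step {γ T : ℝ} {Y : ℝ → F} (hY : IsSolution γ T Y) :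
    ∃ δ, 0 < δ ∧ ∀ s t, 0 ≤ s → s ≤ t → t ≤ T → t ≤ s + δ → ∀ᵐ ξ : ℝ,
      |(Y t).q ξ - (Y s).q ξ| ≤ 1 / 8 * (|(Y s).q ξ| + |(Y s).w ξ| + |(Y s).h ξ|) ∧
      |(Y t).w ξ - (Y s).w ξ| ≤ 1 / 8 * (|(Y s).q ξ| + |(Y s).w ξ| + |(Y s).h ξ|) ∧
      |(Y t).h ξ - (Y s).h ξ| ≤ 1 / 8 * (|(Y s).q ξ| + |(Y s).w ξ| + |(Y s).h ξ|) := by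
  obtain ⟨K, hK, h⟩ := hY.norm_localDensities_sub_le
  -- `K + 1` instead of `K` avoids division by zero. The fraction `1 / 8` is small enough for the
  -- positivity argument.
  refine ⟨1 / (8 * (K + 1)), by positivity, fun s t hs hst ht hδ => ?_⟩
  have hsmall : K * (t - s) ≤ 1 / 8 := by
    calc K * (t - s) ≤ (K + 1) * (1 / (8 * (K + 1))) := by
          refine mul_le_mul (by linarith) (by linarith) (by linarith) (by linarith)
      _ = 1 / 8 := by field_simp
  have hχ : ∀ χ : LInf, ‖localDensities χ (Y t) - localDensities χ (Y s)‖ ≤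
      1 / 8 * ‖localDensities χ (Y s)‖ := fun χ =>
    (h χ s t hs hst ht).trans (mul_le_mul_of_nonneg_right hsmall (norm_nonneg _))
  have key : ∀ D E : L2, (∀ χ : LInf, ‖pmul ∞ 2 2 χ (D - E)‖ ≤
        ‖localDensities χ (Y t) - localDensities χ (Y s)‖) →
      ∀ᵐ ξ : ℝ, |D ξ - E ξ| ≤ 1 / 8 * (|wtq (Y s) ξ| + |wtw (Y s) ξ| + |wth (Y s) ξ|) := by
    intro D E hDE
    have := ae_abs_le_of_forall_indInf (ε := 1 / 8) (by norm_num) (D - E) (wtq (Y s)) (wtw (Y s))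
      (wth (Y s)) fun S hS => (hDE _).trans (hχ _)
    filter_upwards [this, Lp.coeFn_sub D E] with ξ h1 h2
    rwa [h2] at h1
  have k1 := key (wtq (Y t)) (wtq (Y s)) fun χ => by
    rw [map_sub]
    exact norm_fst_le (localDensities χ (Y t) - localDensities χ (Y s))
  have k2 := key (wtw (Y t)) (wtw (Y s)) fun χ => by
    rw [map_sub]
    exact (norm_fst_le _).trans (norm_snd_le (localDensities χ (Y t) - localDensities χ (Y s)))
  have k3 := key (wth (Y t)) (wth (Y s)) fun χ => by
    rw [map_sub]
    exact (norm_snd_le _).trans (norm_snd_le (localDensities χ (Y t) - localDensities χ (Y s)))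
  filter_upwards [k1, k2, k3, coeFn_wtq (Y t), coeFn_wtq (Y s), coeFn_wtw (Y t), coeFn_wtw (Y s),
    coeFn_wth (Y t), coeFn_wth (Y s)] with ξ h1 h2 h3 e1 e2 e3 e4 e5 e6
  have hw := wt_pos ξ
  rw [e1, e2, e4, e6, ← mul_sub] at h1
  rw [e3, e2, e4, e6, ← mul_sub] at h2
  rw [e5, e2, e4, e6, ← mul_sub] at h3
  simp only [abs_mul, abs_of_pos hw] at h1 h2 h3
  refine ⟨?_, ?_, ?_⟩ <;> refine le_of_mul_le_mul_left ?_ hw <;> linarith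

/-! ### Bounded densities -/

/-- In one step each density stays below twice `|q| + |w| + |h|` at the start of the step, and
finitely many steps cover `[0,T]`. -/
lemma IsSolution.boundedDensities {γ T : ℝ} {Y : ℝ → F} (hY : IsSolution γ T Y)
    (h0 : BoundedDensities (Y 0)) : ∀ t ∈ Icc 0 T, BoundedDensities (Y t) := by
  obtain ⟨δ, hδ, hstep⟩ := hY.exists_step
  refine forall_Icc_of_step hδ h0 fun s t hs hst ht htδ hb => ?_
  obtain ⟨b1, b2, b3⟩ := hb
  have hS : MemLp (fun ξ => 2 * (|(Y s).q ξ| + |(Y s).w ξ| + |(Y s).h ξ|)) ∞ volume :=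
    ((b1.abs.add b2.abs).add b3.abs).const_mul 2
  have m1 : AEStronglyMeasurable (Y t).q volume :=
    ((measurable_coeFn (vC (Y t))).add_const 1).aestronglyMeasurable
  have m2 : AEStronglyMeasurable (Y t).w volume := (measurable_coeFn (wC (Y t))).aestronglyMeasurable
  have m3 : AEStronglyMeasurable (Y t).h volume := (measurable_coeFn (hC (Y t))).aestronglyMeasurable
  have h := hstep s t hs hst ht htδ
  refine ⟨hS.mono' m1 ?_, hS.mono' m2 ?_, hS.mono' m3 ?_⟩ <;>
  · filter_upwards [h] with ξ hξ
    obtain ⟨e1, e2, e3⟩ := hξ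
    rw [Real.norm_eq_abs]
    have a1 := abs_sub_abs_le_abs_sub ((Y t).q ξ) ((Y s).q ξ)
    have a2 := abs_sub_abs_le_abs_sub ((Y t).w ξ) ((Y s).w ξ)
    have a3 := abs_sub_abs_le_abs_sub ((Y t).h ξ) ((Y s).h ξ)
    have c1 := abs_nonneg ((Y s).q ξ)
    have c2 := abs_nonneg ((Y s).w ξ)
    have c3 := abs_nonneg ((Y s).h ξ)
    linarith

/-! ### The energy identity -/

/-- The weighted defect `qh - U²q² - w²` in the energy identity as an `L¹` class. -/
def energyDefect (Y : F) : Lp ℝ 1 (volume : Measure ℝ) :=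
  pmul 2 2 1 (wtq Y) (wth Y) -
    pmul 2 2 1 (pmul ∞ 2 2 (UC Y) (wtq Y)) (pmul ∞ 2 2 (UC Y) (wtq Y)) -
    pmul 2 2 1 (wtw Y) (wtw Y)

lemma coeFn_energyDefect (Y : F) : energyDefect Y =ᵐ[volume] fun ξ =>
    wt ξ ^ 2 * (Y.q ξ * Y.h ξ - (Y.U ξ ^ 2 * Y.q ξ ^ 2 + Y.w ξ ^ 2)) := by
  set A := pmul ∞ 2 2 (UC Y) (wtq Y) with hA
  filter_upwards [Lp.coeFn_sub (pmul 2 2 1 (wtq Y) (wth Y) - pmul 2 2 1 A A)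
      (pmul 2 2 1 (wtw Y) (wtw Y)), Lp.coeFn_sub (pmul 2 2 1 (wtq Y) (wth Y)) (pmul 2 2 1 A A),
    coeFn_pmul (r := 1) (wtq Y) (wth Y), coeFn_pmul (r := 1) A A,
    coeFn_pmul (r := 1) (wtw Y) (wtw Y), coeFn_pmul (r := 2) (UC Y) (wtq Y), coeFn_wtq Y,
    coeFn_wtw Y, coeFn_wth Y] with ξ h1 h2 h3 h4 h5 h6 h7 h8 h9
  rw [energyDefect, ← hA, h1, Pi.sub_apply, h2, Pi.sub_apply, h3, h4, h5, hA, h6, h7, h8, h9,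
    coeFn_UC]
  ring

lemma energyDefect_eq_zero_iff (Y : F) : energyDefect Y = 0 ↔ EnergyIdentity Y := by
  have hz : energyDefect Y = 0 ↔ ∀ᵐ ξ : ℝ, energyDefect Y ξ = 0 := by
    rw [Lp.ext_iff]
    exact ⟨fun h => h.trans (Lp.coeFn_zero ℝ 1 volume),
      fun h => EventuallyEq.trans h (Lp.coeFn_zero ℝ 1 volume).symm⟩
  rw [hz]
  refine eventually_congr ?_
  filter_upwards [coeFn_energyDefect Y] with ξ h1
  rw [h1, mul_eq_zero, sub_eq_zero, or_iff_right (pow_ne_zero 2 (wt_pos ξ).ne')]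

/-- The derivative of the energy defect along a curve with velocity `Z`. -/
def energyDefectDeriv (Y Z : F) : Lp ℝ 1 (volume : Measure ℝ) :=
  (pmul 2 2 1 (wtq Y) (pmul ∞ 2 2 wtInf (hC Z)) + pmul 2 2 1 (pmul ∞ 2 2 wtInf (vC Z)) (wth Y)) -
    (pmul 2 2 1 (pmul ∞ 2 2 (UC Y) (wtq Y))
        (pmul ∞ 2 2 (UC Y) (pmul ∞ 2 2 wtInf (vC Z)) + pmul ∞ 2 2 (UC Z) (wtq Y)) +
      pmul 2 2 1 (pmul ∞ 2 2 (UC Y) (pmul ∞ 2 2 wtInf (vC Z)) + pmul ∞ 2 2 (UC Z) (wtq Y))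
        (pmul ∞ 2 2 (UC Y) (wtq Y))) -
    (pmul 2 2 1 (wtw Y) (pmul ∞ 2 2 wtInf (wC Z)) + pmul 2 2 1 (pmul ∞ 2 2 wtInf (wC Z)) (wtw Y))

lemma hasDerivWithinAt_energyDefect {Y : ℝ → F} {Z : F} {s : Set ℝ} {t : ℝ}
    (h : HasDerivWithinAt Y Z s t) :
    HasDerivWithinAt (fun t => energyDefect (Y t)) (energyDefectDeriv (Y t) Z) s t := by
  have hU : HasDerivWithinAt (fun t => UC (Y t)) (UC Z) s t :=
    UC.hasFDerivAt.comp_hasDerivWithinAt t h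
  have hUq := (pmul ∞ 2 2).hasDerivWithinAt_of_bilinear hU (hasDerivWithinAt_wtq h)
  exact (((pmul 2 2 1).hasDerivWithinAt_of_bilinear (hasDerivWithinAt_wtq h)
    (hasDerivWithinAt_wth h)).sub ((pmul 2 2 1).hasDerivWithinAt_of_bilinear hUq hUq)).sub
    ((pmul 2 2 1).hasDerivWithinAt_of_bilinear (hasDerivWithinAt_wtw h) (hasDerivWithinAt_wtw h))

/-- An algebraic cancellation at almost every `ξ`: `γwh` cancels between `q_t h` and `2w w_t`, the
terms in `QUq²` between `q h_t` and `(U²)_t q²`, and the rest among the multiples of `U²qw` and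
`Pqw`. The integral formulas for `P` and `Q` play no role. -/
lemma IsRHS.energyDefectDeriv_eq_zero {γ : ℝ} {Y Z : F} (h : IsRHS γ Y Z) :
    energyDefectDeriv Y Z = 0 := by
  set a := pmul ∞ 2 2 (UC Y) (wtq Y) with ha
  set b := pmul ∞ 2 2 (UC Y) (pmul ∞ 2 2 wtInf (vC Z)) with hb
  set c := pmul ∞ 2 2 (UC Z) (wtq Y) with hc
  set d1 := pmul ∞ 2 2 wtInf (vC Z) with hd1
  set d2 := pmul ∞ 2 2 wtInf (wC Z) with hd2
  set d3 := pmul ∞ 2 2 wtInf (hC Z) with hd3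
  refine Lp.ext ?_
  filter_upwards [Lp.coeFn_sub (pmul 2 2 1 (wtq Y) d3 + pmul 2 2 1 d1 (wth Y) -
      (pmul 2 2 1 a (b + c) + pmul 2 2 1 (b + c) a)) (pmul 2 2 1 (wtw Y) d2 + pmul 2 2 1 d2 (wtw Y)),
    Lp.coeFn_sub (pmul 2 2 1 (wtq Y) d3 + pmul 2 2 1 d1 (wth Y))
      (pmul 2 2 1 a (b + c) + pmul 2 2 1 (b + c) a),
    Lp.coeFn_add (pmul 2 2 1 (wtq Y) d3) (pmul 2 2 1 d1 (wth Y)),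
    Lp.coeFn_add (pmul 2 2 1 a (b + c)) (pmul 2 2 1 (b + c) a),
    Lp.coeFn_add (pmul 2 2 1 (wtw Y) d2) (pmul 2 2 1 d2 (wtw Y)), Lp.coeFn_add b c,
    coeFn_pmul (r := 1) (wtq Y) d3, coeFn_pmul (r := 1) d1 (wth Y), coeFn_pmul (r := 1) a (b + c),
    coeFn_pmul (r := 1) (b + c) a, coeFn_pmul (r := 1) (wtw Y) d2, coeFn_pmul (r := 1) d2 (wtw Y),
    coeFn_pmul (r := 2) (UC Y) (wtq Y), coeFn_pmul (r := 2) (UC Y) d1,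
    coeFn_pmul (r := 2) (UC Z) (wtq Y), coeFn_wt_mul (vC Z), coeFn_wt_mul (wC Z),
    coeFn_wt_mul (hC Z), coeFn_wtq Y, coeFn_wtw Y, coeFn_wth Y, h.U_eq, h.v_eq, h.w_eq, h.h_eq,
    Lp.coeFn_zero ℝ 1 (volume : Measure ℝ)]
    with ξ e1 e2 e3 e4 e5 e6 f1 f2 f3 f4 f5 f6 g1 g2 g3 k1 k2 k3 m1 m2 m3 n1 n2 n3 n4 z
  rw [z, energyDefectDeriv, e1, Pi.sub_apply, e2, Pi.sub_apply, e3, Pi.add_apply, e4,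
    Pi.add_apply, e5, Pi.add_apply, f1, f2, f3, f4, f5, f6, e6, Pi.add_apply, ha, hb, hc, g1, g2,
    g3, hd1, hd2, hd3, k1, k2, k3, m1, m2, m3, coeFn_UC, coeFn_UC, coeFn_vC, coeFn_wC, coeFn_hC,
    n1, n2, n3, n4]
  simp only [Pi.zero_apply]
  ring

lemma IsSolution.energyIdentity {γ T : ℝ} {Y : ℝ → F} (hY : IsSolution γ T Y)
    (h0 : EnergyIdentity (Y 0)) : ∀ t ∈ Icc 0 T, EnergyIdentity (Y t) := by
  intro t ht
  obtain ⟨Y', -, hd⟩ := hY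
  rw [← energyDefect_eq_zero_iff] at h0 ⊢
  -- With `K = 0` the estimate says that the curve is constant.
  have := norm_sub_le_of_norm_deriv_le (K := 0) (T := T) (f := fun t => energyDefect (Y t)) le_rfl
    (fun τ hτ => hasDerivWithinAt_energyDefect (hd τ hτ).1)
    (fun τ hτ => by simp [(hd τ hτ).2.energyDefectDeriv_eq_zero]) le_rfl ht.1 ht.2
  simpa [h0] using this

/-! ### Positive densities -/

lemma IsSolution.positiveDensities {γ T : ℝ} {Y : ℝ → F} (hY : IsSolution γ T Y)
    (hE : EnergyIdentity (Y 0)) (h0 : PositiveDensities (Y 0)) :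
    ∀ t ∈ Icc 0 T, PositiveDensities (Y t) := by
  obtain ⟨δ, hδ, hstep⟩ := hY.exists_step
  have hEt := hY.energyIdentity hE
  refine forall_Icc_of_step hδ h0 fun s t hs hst ht htδ hb => ?_
  obtain ⟨c, hc, hb⟩ := hb
  refine ⟨c / 2, by positivity, ?_⟩
  filter_upwards [hb, hstep s t hs hst ht htδ, hEt s ⟨hs, hst.trans ht⟩, hEt t ⟨hs.trans hst, ht⟩]
    with ξ hξ hd es et
  obtain ⟨p1, p2, p3⟩ := hξ
  obtain ⟨d1, -, d3⟩ := hd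
  -- By the identity `w² ≤ qh ≤ ((q+h)/2)²`.
  have hw : |(Y s).w ξ| ≤ ((Y s).q ξ + (Y s).h ξ) / 2 := by
    refine abs_le_of_sq_le_sq ?_ (by linarith)
    nlinarith [sq_nonneg ((Y s).U ξ * (Y s).q ξ), sq_nonneg ((Y s).q ξ - (Y s).h ξ)]
  rw [abs_of_nonneg p1, abs_of_nonneg p2] at d1 d3
  -- The total size at time `s` is at most `3(q+h)/2`, so `q + h` loses at most `2 · 1/8 · 3/2 =
  -- 3/8` of itself, leaving `5c/8 ≥ c/2`.
  have hsum : c / 2 ≤ (Y t).q ξ + (Y t).h ξ := by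
    linarith [(abs_le.1 d1).1, (abs_le.1 d3).1]
  -- By the identity at time `t` the two factors have the same sign, and their positive sum excludes
  -- the negative case.
  have hprod : 0 ≤ (Y t).q ξ * (Y t).h ξ := by rw [et]; positivity
  rcases mul_nonneg_iff.1 hprod with h | h
  · exact ⟨h.1, h.2, hsum⟩
  · exfalso; linarith [h.1, h.2]


/-! ### Propagation of the derivative relations -/

/-- Closedness makes the quotient seminorm a norm, so a class of norm zero consists of elements of
`derivPairs`. -/
instance instIsClosedDerivPairs : IsClosed (derivPairs : Set (LInf × L2)) := isClosed_derivPairs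

/-- The pair `(ζ, v)`, with weighted second component. -/
def ζPair : F →L[ℝ] LInf × L2 := ζC.prod (pmul ∞ 2 2 wtInf ∘L vC)

/-- The pair `(U, w)`, with weighted second component. -/
def UPair : F →L[ℝ] LInf × L2 := UC.prod (pmul ∞ 2 2 wtInf ∘L wC)

/-- The pair `(H, h)`, with weighted second component. -/
def HPair : F →L[ℝ] LInf × L2 := HC.prod (pmul ∞ 2 2 wtInf ∘L hC)

lemma mk_wt_mul_mem_derivPairs (f : LInf) (g : L2) :
    (f, pmul ∞ 2 2 wtInf g) ∈ derivPairs ↔ HasSpaceDeriv f g := by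
  have e : (fun ξ => (wt ξ)⁻¹ * pmul ∞ 2 2 wtInf g ξ) =ᵐ[volume] g := by
    filter_upwards [coeFn_wt_mul g] with ξ hξ
    rw [hξ, inv_mul_cancel_left₀ (wt_pos ξ).ne']
  exact ⟨fun h => h.congr (ae_eq_refl _) e, fun h => h.congr (ae_eq_refl _) e.symm⟩

lemma hasSpaceDeriv_y_iff (Y : F) : HasSpaceDeriv Y.y Y.q ↔ HasSpaceDeriv Y.ζ Y.v := by
  refine ⟨fun h => ?_, fun h => h.add hasSpaceDeriv_id⟩
  refine (h.add (hasSpaceDeriv_id.const_mul (-1))).congr (Eventually.of_forall fun ξ => ?_)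
    (Eventually.of_forall fun ξ => ?_)
  · simp [y]
  · simp [q]

lemma derivativeRelations_iff (Y : F) : DerivativeRelations Y ↔
    ζPair Y ∈ derivPairs ∧ UPair Y ∈ derivPairs ∧ HPair Y ∈ derivPairs := by
  unfold DerivativeRelations
  rw [hasSpaceDeriv_y_iff]
  exact and_congr (mk_wt_mul_mem_derivPairs (ζC Y) (vC Y)).symm
    (and_congr (mk_wt_mul_mem_derivPairs (UC Y) (wC Y)).symm
      (mk_wt_mul_mem_derivPairs (HC Y) (hC Y)).symm)

/-- The velocity of `(U, w)` as a function of `(ζ, v)`, for a frozen source term. -/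
def UVelocity (g : L2) (p : LInf × L2) : LInf × L2 :=
  (-nonlocalQ p.1 g, pmul ∞ 2 2 wtInf g - pmul ∞ 2 2 (nonlocalP p.1 g) (p.2 + wtTwo))

/-- The equation for `w` regroups as `w_t = g - Pq` with `g` the source of `P` and `Q`. With `g`
frozen, only `(ζ, v)` is left as a variable. -/
lemma IsRHS.UPair_eq {γ : ℝ} {Y Z : F} (h : IsRHS γ Y Z) :
    UPair Z = UVelocity (source γ Y) (ζPair Y) := by
  refine Prod.ext h.UC_eq (Lp.ext ?_)
  change pmul ∞ 2 2 wtInf (wC Z) =ᵐ[volume]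
    (pmul ∞ 2 2 wtInf (source γ Y) - pmul ∞ 2 2 (PC γ Y) (wtq Y) : L2)
  filter_upwards [Lp.coeFn_sub (pmul ∞ 2 2 wtInf (source γ Y)) (pmul ∞ 2 2 (PC γ Y) (wtq Y)),
    coeFn_wt_mul (wC Z), coeFn_wt_mul (source γ Y), coeFn_pmul (r := 2) (PC γ Y) (wtq Y),
    coeFn_PC γ Y, coeFn_source γ Y, coeFn_wtq Y, h.w_eq] with ξ h1 h2 h3 h4 h5 h6 h7 h8
  rw [h1, h2, Pi.sub_apply, h3, h4, h5, h6, h7, coeFn_wC, h8]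
  ring

/-- This is `Q_ξ = P(1 + ζ_ξ) - g`, valid for an arbitrary `g ∈ L²`; hence no relation between `h`
and `H` is used. -/
lemma UVelocity_mem_derivPairs (g : L2) {p : LInf × L2} (hp : p ∈ derivPairs) :
    UVelocity g p ∈ derivPairs := by
  have h := (hasSpaceDeriv_nonlocal (mem_derivPairs.1 hp) g).2
  refine (h.const_mul (-1)).congr ?_ ?_
  · filter_upwards [Lp.coeFn_neg (nonlocalQ p.1 g)] with ξ h1
    rw [UVelocity, h1, Pi.neg_apply]
    ring
  · filter_upwards [Lp.coeFn_sub (pmul ∞ 2 2 wtInf g)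
        (pmul ∞ 2 2 (nonlocalP p.1 g) (p.2 + wtTwo)), coeFn_wt_mul g,
      coeFn_pmul (r := 2) (nonlocalP p.1 g) (p.2 + wtTwo), Lp.coeFn_add p.2 wtTwo, coeFn_wtTwo]
      with ξ h1 h2 h3 h4 h5
    rw [UVelocity, h1, Pi.sub_apply, h2, h3, h4, Pi.add_apply, h5]
    have := (wt_pos ξ).ne'
    field_simp
    ring

lemma norm_UVelocity_sub_le (g : L2) (p p' : LInf × L2) {R : ℝ} (h : ‖p.1‖ ≤ R) (h' : ‖p'.1‖ ≤ R) :
    ‖UVelocity g p - UVelocity g p'‖ ≤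
      Real.exp (2 * R) * ‖g‖ * (‖p.2 + wtTwo‖ + 1) * ‖p - p'‖ := by
  have e1 : ‖p.1 - p'.1‖ ≤ ‖p - p'‖ := norm_fst_le (p - p')
  have e2 : ‖p.2 - p'.2‖ ≤ ‖p - p'‖ := norm_snd_le (p - p')
  have hP := norm_nonlocalP_sub_le p.1 p'.1 g h h'
  have hQ := norm_nonlocalQ_sub_le p.1 p'.1 g h h'
  have hP' : ‖nonlocalP p'.1 g‖ ≤ Real.exp (2 * R) * ‖g‖ :=
    (norm_nonlocalP_le _ _).trans (by gcongr)
  set c := Real.exp (2 * R) * ‖g‖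
  have hc : 0 ≤ c := by positivity
  have hcp : 0 ≤ c * ‖p.2 + wtTwo‖ * ‖p - p'‖ := by positivity
  have hc1 : c * ‖p.1 - p'.1‖ ≤ c * ‖p - p'‖ := by gcongr
  refine max_le ?_ ?_
  · change ‖-nonlocalQ p.1 g - -nonlocalQ p'.1 g‖ ≤ _
    rw [neg_sub_neg, norm_sub_rev]
    linarith
  · change ‖(pmul ∞ 2 2 wtInf g - pmul ∞ 2 2 (nonlocalP p.1 g) (p.2 + wtTwo)) -
      (pmul ∞ 2 2 wtInf g - pmul ∞ 2 2 (nonlocalP p'.1 g) (p'.2 + wtTwo))‖ ≤ _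
    have : (pmul ∞ 2 2 wtInf g - pmul ∞ 2 2 (nonlocalP p.1 g) (p.2 + wtTwo)) -
        (pmul ∞ 2 2 wtInf g - pmul ∞ 2 2 (nonlocalP p'.1 g) (p'.2 + wtTwo)) =
        -(pmul ∞ 2 2 (nonlocalP p.1 g - nonlocalP p'.1 g) (p.2 + wtTwo) +
          pmul ∞ 2 2 (nonlocalP p'.1 g) (p.2 - p'.2)) := by
      simp only [map_sub, map_add, sub_apply]
      abel
    rw [this, norm_neg]
    refine (norm_add_le _ _).trans ?_
    calc _ ≤ c * ‖p - p'‖ * ‖p.2 + wtTwo‖ + c * ‖p - p'‖ :=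
          add_le_add ((norm_pmul_le _ _).trans (by gcongr; exact hP.trans hc1))
            ((norm_pmul_le _ _).trans (by gcongr))
      _ = _ := by ring

/-- The velocity of `(U, w)` modulo `derivPairs` is controlled by `(ζ, v)` modulo `derivPairs`. -/
lemma norm_mk_UVelocity_le (g : L2) (p : LInf × L2) {R : ℝ} (h1 : ‖p.1‖ ≤ R) (h2 : ‖g‖ ≤ R)
    (h3 : ‖p.2 + wtTwo‖ ≤ R) {R' : ℝ} (hR' : ‖derivPairs.mkQL p‖ + 1 + R ≤ R') :
    ‖derivPairs.mkQL (UVelocity g p)‖ ≤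
      Real.exp (2 * R') * R * (R + 1) * ‖derivPairs.mkQL p‖ := by
  have hR : 0 ≤ R := (norm_nonneg _).trans h1
  set L := Real.exp (2 * R') * R * (R + 1)
  have hL : 0 ≤ L := by positivity
  -- The restriction `ε ≤ 1` keeps the representatives used below in the ball of radius `R'`, so the
  -- Lipschitz constant does not depend on `ε`.
  have key : ∀ ε, 0 < ε → ε ≤ 1 →
      ‖derivPairs.mkQL (UVelocity g p)‖ ≤ L * (‖derivPairs.mkQL p‖ + ε) := by
    intro ε hε hε1
    -- For an almost minimal representative `d` of the class of `p`, the velocity at `p - d` lies in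
    -- `derivPairs`. Subtracting it does not change the class and leaves a difference of size
    -- `O(‖d‖)`.
    obtain ⟨d, hd, hdn⟩ := Submodule.Quotient.norm_mk_lt (derivPairs.mkQL p) hε
    have hm : p - d ∈ derivPairs := by
      rw [← Submodule.Quotient.eq]
      exact hd.symm
    have hd1 : ‖d.1‖ ≤ ‖d‖ := norm_fst_le d
    have e : derivPairs.mkQL (UVelocity g p) =
        Submodule.Quotient.mk (UVelocity g p - UVelocity g (p - d)) := by
      refine (Submodule.Quotient.eq _).2 ?_
      rw [sub_sub_cancel]
      exact UVelocity_mem_derivPairs g hm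
    rw [e]
    refine (Submodule.Quotient.norm_mk_le derivPairs _).trans ?_
    refine (norm_UVelocity_sub_le g p (p - d) (R := R') ?_ ?_).trans ?_
    · linarith [norm_nonneg (derivPairs.mkQL p)]
    · refine (norm_sub_le p.1 d.1).trans ?_
      linarith
    · rw [sub_sub_cancel]
      refine mul_le_mul ?_ hdn.le (norm_nonneg _) hL
      exact mul_le_mul (mul_le_mul_of_nonneg_left h2 (Real.exp_pos _).le) (by linarith)
        (by positivity) (by positivity)
  refine le_of_forall_pos_le_add fun ε hε => ?_
  have hη : 0 < min 1 (ε / (L + 1)) := by positivity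
  refine (key _ hη (min_le_left _ _)).trans ?_
  rw [mul_add]
  gcongr
  calc L * min 1 (ε / (L + 1)) ≤ (L + 1) * (ε / (L + 1)) := by
        gcongr
        · linarith
        · exact min_le_right _ _
    _ = ε := by field_simp

lemma mem_derivPairs_iff_mkQL {p : LInf × L2} : p ∈ derivPairs ↔ derivPairs.mkQL p = 0 :=
  (Submodule.Quotient.mk_eq_zero derivPairs).symm

lemma IsSolution.exists_mkQL_bound {γ T : ℝ} {Y : ℝ → F} (hY : IsSolution γ T Y) :
    ∃ L, 0 ≤ L ∧ ∀ t ∈ Icc 0 T, ‖derivPairs.mkQL (UVelocity (source γ (Y t)) (ζPair (Y t)))‖ ≤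
      L * ‖derivPairs.mkQL (ζPair (Y t))‖ := by
  obtain ⟨R, hR, hb⟩ := hY.exists_bound
  obtain ⟨B, hB⟩ := isCompact_Icc.exists_bound_of_continuousOn
    ((derivPairs.mkQL ∘L ζPair).continuous.comp_continuousOn hY.continuousOn)
  refine ⟨Real.exp (2 * (B + 1 + R)) * R * (R + 1), by positivity, fun t ht => ?_⟩
  obtain ⟨b1, -, b3, b4⟩ := hb t ht
  have hB' : ‖derivPairs.mkQL (ζPair (Y t))‖ ≤ B := hB t ht
  exact norm_mk_UVelocity_le (source γ (Y t)) (ζPair (Y t)) b1 b3 b4 (by linarith)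

/-- Modulo `derivPairs`, the pairs `(ζ, v)` and `(U, w)` satisfy a closed linear differential
inequality with zero initial value. They have to be treated together, since each controls the
velocity of the other. -/
lemma IsSolution.ζPair_UPair_mem {γ T : ℝ} {Y : ℝ → F} (hY : IsSolution γ T Y)
    (h1 : ζPair (Y 0) ∈ derivPairs) (h2 : UPair (Y 0) ∈ derivPairs) :
    ∀ t ∈ Icc 0 T, ζPair (Y t) ∈ derivPairs ∧ UPair (Y t) ∈ derivPairs := by
  intro t ht
  obtain ⟨L, hL, hb⟩ := hY.exists_mkQL_bound
  obtain ⟨Y', -, hd⟩ := hY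
  set f : F →L[ℝ] ((LInf × L2) ⧸ derivPairs) × ((LInf × L2) ⧸ derivPairs) :=
    (derivPairs.mkQL ∘L ζPair).prod (derivPairs.mkQL ∘L UPair) with hf
  have hfst : ∀ Z, (f Z).1 = derivPairs.mkQL (ζPair Z) := fun _ => rfl
  have hsnd : ∀ Z, (f Z).2 = derivPairs.mkQL (UPair Z) := fun _ => rfl
  have hbound : ∀ τ ∈ Icc 0 T, ‖f (Y' τ)‖ ≤ (|γ| + L) * ‖f (Y τ)‖ := by
    intro τ hτ
    have hr := (hd τ hτ).2
    have n1 : ‖derivPairs.mkQL (ζPair (Y τ))‖ ≤ ‖f (Y τ)‖ := norm_fst_le (f (Y τ))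
    have n2 : ‖derivPairs.mkQL (UPair (Y τ))‖ ≤ ‖f (Y τ)‖ := norm_snd_le (f (Y τ))
    have a1 : 0 ≤ |γ| * ‖f (Y τ)‖ := by positivity
    have a2 : 0 ≤ L * ‖f (Y τ)‖ := by positivity
    rw [add_mul]
    refine max_le ?_ ?_
    · have e : ζPair (Y' τ) = γ • UPair (Y τ) := Prod.ext hr.ζC_eq hr.wt_vC_eq
      rw [hfst, e, map_smul, norm_smul, Real.norm_eq_abs]
      have := mul_le_mul_of_nonneg_left n2 (abs_nonneg γ)
      linarith
    · rw [hsnd, hr.UPair_eq]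
      have := mul_le_mul_of_nonneg_left n1 hL
      linarith [hb τ hτ]
  have key := norm_sub_le_of_norm_deriv_le (K := |γ| + L) (T := T) (f := fun t => f (Y t))
    (f' := fun t => f (Y' t)) (by positivity)
    (fun τ hτ => f.hasFDerivAt.comp_hasDerivWithinAt τ (hd τ hτ).1) hbound le_rfl ht.1 ht.2
  have hz : f (Y 0) = 0 :=
    Prod.ext (mem_derivPairs_iff_mkQL.1 h1) (mem_derivPairs_iff_mkQL.1 h2)
  simp only [hz] at key
  rw [norm_zero, mul_zero, sub_zero] at key
  have h0 := norm_le_zero_iff.1 key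
  exact ⟨mem_derivPairs_iff_mkQL.2 (congrArg Prod.fst h0),
    mem_derivPairs_iff_mkQL.2 (congrArg Prod.snd h0)⟩

/-- With `P_ξ = Qq` and `U_ξ = w`, the product rule gives `(U³ - 2PU)_ξ = 3U²w - 2QqU - 2Pw`, which
is `h_t`. -/
lemma IsRHS.HPair_mem {γ : ℝ} {Y Z : F} (h : IsRHS γ Y Z) (h1 : ζPair Y ∈ derivPairs)
    (h2 : UPair Y ∈ derivPairs) : HPair Z ∈ derivPairs := by
  refine (mk_wt_mul_mem_derivPairs (HC Z) (hC Z)).2 ?_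
  have hζ : HasSpaceDeriv (ζC Y) (vC Y) := (mk_wt_mul_mem_derivPairs _ _).1 h1
  have hU : HasSpaceDeriv Y.U Y.w := (mk_wt_mul_mem_derivPairs (UC Y) (wC Y)).1 h2
  have hP : HasSpaceDeriv (PC γ Y) fun ξ => QC γ Y ξ * (1 + Y.v ξ) :=
    (hasSpaceDeriv_nonlocal hζ (source γ Y)).1
  refine (((hU.mul hU).mul hU).add ((hP.mul hU).const_mul (-2))).congr ?_ ?_
  · filter_upwards [h.H_eq, coeFn_PC γ Y] with ξ e1 e2
    rw [coeFn_HC, e1, e2]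
    ring
  · filter_upwards [h.h_eq, coeFn_PC γ Y, coeFn_QC γ Y] with ξ e1 e2 e3
    rw [coeFn_hC, e1, e2, e3]
    unfold q
    ring

lemma IsSolution.derivativeRelations {γ T : ℝ} {Y : ℝ → F} (hY : IsSolution γ T Y)
    (h0 : DerivativeRelations (Y 0)) : ∀ t ∈ Icc 0 T, DerivativeRelations (Y t) := by
  intro t ht
  rw [derivativeRelations_iff] at h0 ⊢
  obtain ⟨h1, h2, h3⟩ := h0
  have hm := hY.ζPair_UPair_mem h1 h2
  refine ⟨(hm t ht).1, (hm t ht).2, ?_⟩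
  obtain ⟨Y', -, hd⟩ := hY
  have key := norm_sub_le_of_norm_deriv_le (K := 0) (T := T)
    (f := fun t => derivPairs.mkQL (HPair (Y t))) (f' := fun t => derivPairs.mkQL (HPair (Y' t)))
    le_rfl (fun τ hτ => (derivPairs.mkQL ∘L HPair).hasFDerivAt.comp_hasDerivWithinAt τ (hd τ hτ).1)
    (fun τ hτ => by
      rw [mem_derivPairs_iff_mkQL.1 ((hd τ hτ).2.HPair_mem (hm τ hτ).1 (hm τ hτ).2)]
      simp) le_rfl ht.1 ht.2
  rw [mem_derivPairs_iff_mkQL.1 h3] at key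
  exact mem_derivPairs_iff_mkQL.2 (by simpa using key)

end HyperelasticRod

end

theorem mainTheorem12 (γ T : ℝ) (hT : 0 < T) (Y : ℝ → HyperelasticRod.F)
    (hY : HyperelasticRod.IsSolution γ T Y) :
    (HyperelasticRod.BoundedDensities (Y 0) →
      ∀ t ∈ Set.Icc 0 T, HyperelasticRod.BoundedDensities (Y t)) ∧
    (HyperelasticRod.EnergyIdentity (Y 0) →
      ∀ t ∈ Set.Icc 0 T, HyperelasticRod.EnergyIdentity (Y t)) ∧
    (HyperelasticRod.EnergyIdentity (Y 0) ∧ HyperelasticRod.PositiveDensities (Y 0) →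
      ∀ t ∈ Set.Icc 0 T,
        HyperelasticRod.EnergyIdentity (Y t) ∧ HyperelasticRod.PositiveDensities (Y t)) ∧
    (HyperelasticRod.DerivativeRelations (Y 0) →
      ∀ t ∈ Set.Icc 0 T, HyperelasticRod.DerivativeRelations (Y t)) := by
  exact ⟨hY.boundedDensities, hY.energyIdentity,
    fun h t ht => ⟨hY.energyIdentity h.1 t ht, hY.positiveDensities h.1 h.2 t ht⟩,
    hY.derivativeRelations⟩
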